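/- Let $(M,g)$ be a connected, complete, real-analytic Riemannian manifold (of finite dimension, without boundary; both the manifold and the metric are real-analytic), let $E\subset M$ be open and connected, and let $p\in E$. A parallel complex structure on an open set $W\subset M$ is a smooth field $J$ of endomorphisms of the tangent spaces $T_xM$, $x\in W$, with $J^2=-\mathrm{Id}$, with vanishing Nijenhuis tensor, and with $\nabla J=0$ for the Levi-Civita connection $\nabla$ of $g$. Suppose that the homomorphism $\pi_1(E,p)\to\pi_1(M,p)$ induced by the inclusion is surjective. Then for every parallel complex structure $J_E$ on $E$ there is exactly one parallel complex structure $J$ on $M$ with $J|_E=J_E$. Moreover, for every $q\in M$ and every piecewise smooth path $\gamma$ from $p$ to $q$, $$J(q)=P_\gamma\circ J_E(p)\circ P_\gamma^{-1},$$ where $P_\gamma:T_pM\to T_qM$ denotes parallel transport along $\gamma$. -/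

import Mathlib

open Bundle FiberBundle VectorField
open scoped Manifold ContDiff Topology

noncomputable section

namespace RiemGeom

/-! ## The Levi-Civita connection, constructed from the Koszul formula -/

section LeviCivita

variable {E : Type*} [NormedAddCommGroup E] [NormedSpace ℝ E]
  {H : Type*} [TopologicalSpace H] (I : ModelWithCorners ℝ E H)
  {M : Type*} [TopologicalSpace M] [ChartedSpace H M]
  [RiemannianBundle (fun x : M ↦ TangentSpace I x)]

/-- The right-hand side of the Koszul formula for `2 ⟨∇_X Y, Z⟩` at the point `x`. -/
def koszul (X Y Z : Π x : M, TangentSpace I x) (x : M) : ℝ :=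
  d% (fun y ↦ inner ℝ (Y y) (Z y)) x (X x)
    + d% (fun y ↦ inner ℝ (X y) (Z y)) x (Y x)
    - d% (fun y ↦ inner ℝ (X y) (Y y)) x (Z x)
    + inner ℝ (mlieBracket I X Y x) (Z x)
    - inner ℝ (mlieBracket I X Z x) (Y x)
    - inner ℝ (mlieBracket I Y Z x) (X x)

variable [IsManifold I 2 M]
  [IsContMDiffRiemannianBundle I 1 E (fun x : M ↦ TangentSpace I x)]

variable {I}

theorem mdiffAt_inner {x : M} {X Y : Π x : M, TangentSpace I x}
    (hX : MDiffAt (T% X) x) (hY : MDiffAt (T% Y) x) :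
    MDiffAt (fun y ↦ inner ℝ (X y) (Y y)) x :=
  MDifferentiableAt.inner_bundle (IB := I) (F := E) (E := fun x : M ↦ TangentSpace I x) (b := id)
    hX hY

variable [FiniteDimensional ℝ E]

theorem koszul_tensorial_left {x : M} {Y Z : Π x : M, TangentSpace I x}
    (hY : MDiffAt (T% Y) x) (hZ : MDiffAt (T% Z) x) :
    TensorialAt I E (fun X ↦ koszul I X Y Z x) x where
  smul {f X} hf hX := by
    have : CompleteSpace E := FiniteDimensional.complete ℝ E
    simp [koszul, mlieBracket_smul_left hf hX, mvfderiv_fun_mul hf (mdiffAt_inner hX hY),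
      mvfderiv_fun_mul hf (mdiffAt_inner hX hZ), inner_add_left, inner_smul_left, inner_smul_right]
    ring
  add {X X'} hX hX' := by
    have : CompleteSpace E := FiniteDimensional.complete ℝ E
    simp [koszul, mlieBracket_add_left hX hX',
      mvfderiv_fun_add (mdiffAt_inner hX hY) (mdiffAt_inner hX' hY),
      mvfderiv_fun_add (mdiffAt_inner hX hZ) (mdiffAt_inner hX' hZ),
      inner_add_left, inner_add_right]
    ring

theorem koszul_tensorial_right {x : M} {X Y : Π x : M, TangentSpace I x}
    (hX : MDiffAt (T% X) x) (hY : MDiffAt (T% Y) x) :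
    TensorialAt I E (fun Z ↦ koszul I X Y Z x) x where
  smul {f Z} hf hZ := by
    have : CompleteSpace E := FiniteDimensional.complete ℝ E
    simp [koszul, mlieBracket_smul_right hf hZ, mvfderiv_fun_mul hf (mdiffAt_inner hX hZ),
      mvfderiv_fun_mul hf (mdiffAt_inner hY hZ), inner_add_left, inner_smul_left, inner_smul_right,
      real_inner_comm]
    ring
  add {Z Z'} hZ hZ' := by
    have : CompleteSpace E := FiniteDimensional.complete ℝ E
    simp [koszul, mlieBracket_add_right hZ hZ',
      mvfderiv_fun_add (mdiffAt_inner hX hZ) (mdiffAt_inner hX hZ'),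
      mvfderiv_fun_add (mdiffAt_inner hY hZ) (mdiffAt_inner hY hZ'),
      inner_add_left, inner_add_right]
    ring

open Classical in
/-- The bilinear form `(v, w) ↦ 2 ⟨∇_v Y, w⟩` on `T_x M` given by the Koszul formula, for a vector
field `Y` that is differentiable at `x`. It is `0` (a junk value) for the other vector fields. -/
def koszulForm (Y : Π x : M, TangentSpace I x) (x : M) :
    TangentSpace I x →L[ℝ] TangentSpace I x →L[ℝ] ℝ :=
  if hY : MDiffAt (T% Y) x then
    TensorialAt.mkHom₂ (fun X Z ↦ koszul I X Y Z x) x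
      (fun _ hZ ↦ koszul_tensorial_left hY hZ) (fun _ hX ↦ koszul_tensorial_right hX hY)
  else 0

/-- `v ↦ ∇_v Y` at the point `x`: the Riesz representative of half the Koszul form. -/
def leviCivitaFun (Y : Π x : M, TangentSpace I x) (x : M) :
    TangentSpace I x →L[ℝ] TangentSpace I x :=
  haveI : FiniteDimensional ℝ (TangentSpace I x) := inferInstanceAs (FiniteDimensional ℝ E)
  haveI : CompleteSpace (TangentSpace I x) := FiniteDimensional.complete ℝ (TangentSpace I x)
  (1 / 2 : ℝ) • ((InnerProductSpace.toDual ℝ (TangentSpace I x)).symm.toContinuousLinearEquiv :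
      StrongDual ℝ (TangentSpace I x) →L⋆[ℝ] TangentSpace I x) ∘L koszulForm Y x

theorem inner_leviCivitaFun {x : M} {X Y Z : Π x : M, TangentSpace I x}
    (hX : MDiffAt (T% X) x) (hY : MDiffAt (T% Y) x) (hZ : MDiffAt (T% Z) x) :
    2 * inner ℝ (leviCivitaFun Y x (X x)) (Z x) = koszul I X Y Z x := by
  have : koszulForm Y x (X x) (Z x) = koszul I X Y Z x := by
    rw [koszulForm, dif_pos hY, TensorialAt.mkHom₂_apply _ _ hX hZ]
  rw [← this]
  simp [leviCivitaFun, inner_smul_left]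

theorem leviCivitaFun_eq {x : M} {Y : Π x : M, TangentSpace I x} (hY : MDiffAt (T% Y) x)
    {A : TangentSpace I x →L[ℝ] TangentSpace I x}
    (h : ∀ X Z : Π x : M, TangentSpace I x, MDiffAt (T% X) x → MDiffAt (T% Z) x →
      2 * inner ℝ (A (X x)) (Z x) = koszul I X Y Z x) : leviCivitaFun Y x = A := by
  ext v
  refine ext_inner_right ℝ fun w ↦ ?_
  have hX := mdifferentiableAt_extend I E v
  have hZ := mdifferentiableAt_extend I E w
  have h1 := h _ _ hX hZ
  rw [← inner_leviCivitaFun hX hY hZ] at h1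
  simpa using h1.symm

variable (I M) in
/-- The Levi-Civita connection of a Riemannian manifold; `leviCivita I M Y x v` is `∇_v Y` at `x`.
It is torsion-free and metric, see `leviCivita_torsion` and `leviCivita_metric`. -/
def leviCivita : CovariantDerivative I E (fun x : M ↦ TangentSpace I x) where
  toFun := leviCivitaFun
  isCovariantDerivativeOnUniv :=
    { add := by
        intro Y Y' x hY hY' _
        have : CompleteSpace E := FiniteDimensional.complete ℝ E
        refine leviCivitaFun_eq (mdifferentiableAt_add_section hY hY') fun X Z hX hZ ↦ ?_
        have h1 := inner_leviCivitaFun hX hY hZ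
        have h2 := inner_leviCivitaFun hX hY' hZ
        simp only [add_apply, inner_add_left, mul_add, h1, h2]
        simp [koszul, mlieBracket_add_left hY hY', mlieBracket_add_right hY hY',
          mvfderiv_fun_add (mdiffAt_inner hX hY) (mdiffAt_inner hX hY'),
          mvfderiv_fun_add (mdiffAt_inner hY hZ) (mdiffAt_inner hY' hZ), inner_add_left,
          inner_add_right]
        ring
      leibniz := by
        intro Y f x hY hf _
        have : CompleteSpace E := FiniteDimensional.complete ℝ E
        refine leviCivitaFun_eq (hf.smul_section hY) fun X Z hX hZ ↦ ?_
        have h1 := inner_leviCivitaFun hX hY hZ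
        simp only [add_apply, inner_add_left, mul_add, smul_apply,
          inner_smul_left, ContinuousLinearMap.smulRight_apply]
        simp [koszul, mlieBracket_smul_left hf hY, mlieBracket_smul_right hf hY,
          mvfderiv_fun_mul hf (mdiffAt_inner hX hY),
          mvfderiv_fun_mul hf (mdiffAt_inner hY hZ), inner_add_left,
          inner_smul_left, inner_smul_right] at h1 ⊢
        have e1 := real_inner_comm (X x) (Y x)
        linear_combination f x * h1 - (d% f x) (Z x) * e1 }

theorem leviCivita_torsion [CompleteSpace E] : (leviCivita I M).torsion = 0 := by
  rw [CovariantDerivative.torsion_eq_zero_iff]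
  intro X Y x hX hY
  refine ext_inner_right ℝ fun w ↦ ?_
  have hZ := mdifferentiableAt_extend I E w
  have h1 := inner_leviCivitaFun hX hY hZ
  have h2 := inner_leviCivitaFun hY hX hZ
  have e : (fun y ↦ inner ℝ (X y) (Y y)) = fun y ↦ inner ℝ (Y y) (X y) := by
    ext; exact real_inner_comm _ _
  rw [koszul] at h1 h2
  rw [e] at h1
  rw [mlieBracket_swap_apply (V := Y) (W := X)] at h2
  simp only [extend_apply_self, inner_neg_left] at h1 h2
  rw [inner_sub_left]
  change inner ℝ (leviCivitaFun Y x (X x)) w - inner ℝ (leviCivitaFun X x (Y x)) w = _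
  linear_combination (h1 - h2) / 2

theorem leviCivita_metric {X Y Z : Π x : M, TangentSpace I x} {x : M}
    (hX : MDiffAt (T% X) x) (hY : MDiffAt (T% Y) x) (hZ : MDiffAt (T% Z) x) :
    d% (fun y ↦ inner ℝ (Y y) (Z y)) x (X x) =
      inner ℝ (leviCivita I M Y x (X x)) (Z x) + inner ℝ (Y x) (leviCivita I M Z x (X x)) := by
  have h1 := inner_leviCivitaFun hX hY hZ
  have h2 := inner_leviCivitaFun hX hZ hY
  have e : (fun y ↦ inner ℝ (Z y) (Y y)) = fun y ↦ inner ℝ (Y y) (Z y) := by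
    ext; exact real_inner_comm _ _
  rw [koszul] at h1 h2
  rw [e, mlieBracket_swap_apply (V := Z) (W := Y)] at h2
  simp only [inner_neg_left] at h1 h2
  rw [real_inner_comm (leviCivita I M Z x (X x))]
  change _ = inner ℝ (leviCivitaFun Y x (X x)) (Z x) + inner ℝ (leviCivitaFun Z x (X x)) (Y x)
  linear_combination -(h1 + h2) / 2

end LeviCivita

/-! ## Parallel complex structures and parallel transport -/

section Parallel

variable {E : Type*} [NormedAddCommGroup E] [NormedSpace ℝ E] [FiniteDimensional ℝ E]
  {H : Type*} [TopologicalSpace H] (I : ModelWithCorners ℝ E H)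
  {M : Type*} [TopologicalSpace M] [ChartedSpace H M] [IsManifold I 2 M]
  [RiemannianBundle (fun x : M ↦ TangentSpace I x)]
  [IsContMDiffRiemannianBundle I 1 E (fun x : M ↦ TangentSpace I x)]

/-- `J` restricts to a parallel complex structure on the open set `U`: a smooth field of
endomorphisms of the tangent spaces with `J² = -1`, with vanishing Nijenhuis tensor (so that `J` is
an integrable almost complex structure) and with `∇J = 0`, that is `∇_v (J Y) = J (∇_v Y)` for all
smooth vector fields `Y` and tangent vectors `v`. The values of `J` outside of `U` play no role. -/
structure IsParallelComplexStructureOn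
    (J : Π x : M, TangentSpace I x →L[ℝ] TangentSpace I x) (U : Set M) : Prop where
  smooth : ContMDiffOn I (I.prod 𝓘(ℝ, E →L[ℝ] E)) ∞
    (fun x ↦ (⟨x, J x⟩ : TotalSpace (E →L[ℝ] E)
      (fun x : M ↦ TangentSpace I x →L[ℝ] TangentSpace I x))) U
  sq : ∀ x ∈ U, ∀ v : TangentSpace I x, J x (J x v) = -v
  integrable : ∀ x ∈ U, ∀ X Y : Π x : M, TangentSpace I x,
    ContMDiffAt I I.tangent ∞ (fun y ↦ (⟨y, X y⟩ : TangentBundle I M)) x →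
    ContMDiffAt I I.tangent ∞ (fun y ↦ (⟨y, Y y⟩ : TangentBundle I M)) x →
    mlieBracket I (fun y ↦ J y (X y)) (fun y ↦ J y (Y y)) x
      - J x (mlieBracket I (fun y ↦ J y (X y)) Y x)
      - J x (mlieBracket I X (fun y ↦ J y (Y y)) x)
      - mlieBracket I X Y x = 0
  parallel : ∀ x ∈ U, ∀ Y : Π x : M, TangentSpace I x,
    ContMDiffAt I I.tangent ∞ (fun y ↦ (⟨y, Y y⟩ : TangentBundle I M)) x →
    ∀ v : TangentSpace I x,
      leviCivita I M (fun y ↦ J y (Y y)) x v = J x (leviCivita I M Y x v)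

/-- A continuous, piecewise smooth path `[0, 1] → M`: it is smooth on each closed subinterval of
`[0, 1]` whose interior avoids a fixed finite set of break points. The values of `γ` outside of
`[0, 1]` play no role. -/
def IsPiecewiseSmoothPath {M : Type*} [TopologicalSpace M] [ChartedSpace H M] (γ : ℝ → M) : Prop :=
  ContinuousOn γ (Set.Icc 0 1) ∧
    ∃ s : Finset ℝ, ∀ c d : ℝ, 0 ≤ c → c < d → d ≤ 1 → Disjoint (Set.Ioo c d) (s : Set ℝ) →
      ContMDiffOn 𝓘(ℝ, ℝ) I ∞ γ (Set.Icc c d)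

/-- The covariant derivative `D_t V` of a vector field `V` along a curve `γ`. Writing
`V(s) = ∑ Vⁱ(s) eᵢ(γ(s))` in the local frame `eᵢ` of the standard trivialization of the tangent
bundle around `γ(t)`, it is `∑ (dVⁱ/dt) eᵢ + ∑ Vⁱ(t) ∇_{γ'(t)} eᵢ`. Here `extend E (V t)` is the
vector field `∑ Vⁱ(t) eᵢ` with constant coefficients in this frame. -/
def covDerivAlong (γ : ℝ → M) (V : Π t : ℝ, TangentSpace I (γ t)) (t : ℝ) :
    TangentSpace I (γ t) :=
  let e := trivializationAt E (fun x : M ↦ TangentSpace I x) (γ t)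
  e.symm (γ t) (deriv (fun s : ℝ ↦ (e ⟨γ s, V s⟩).2) t)
    + leviCivita I M (extend E (V t)) (γ t) (mfderiv 𝓘(ℝ, ℝ) I γ t (1 : ℝ))

/-- `V` is a parallel vector field along the piecewise smooth path `γ` on `[0, 1]`: it is
continuous, and away from finitely many times it is differentiable with `D_t V = 0`. -/
def IsParallelAlong (γ : ℝ → M) (V : Π t : ℝ, TangentSpace I (γ t)) : Prop :=
  ContinuousOn (fun t : ℝ ↦ (⟨γ t, V t⟩ : TangentBundle I M)) (Set.Icc 0 1) ∧
    ∃ s : Finset ℝ, ∀ t ∈ Set.Ioo (0 : ℝ) 1, t ∉ s →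
      MDifferentiableAt 𝓘(ℝ, ℝ) I.tangent (fun u : ℝ ↦ (⟨γ u, V u⟩ : TangentBundle I M)) t ∧
      covDerivAlong I γ V t = 0

/-- `P` is the parallel transport `T_{γ(0)} M → T_{γ(1)} M` along the path `γ`: for each tangent
vector `v` at `γ(0)`, the parallel vector fields along `γ` with initial value `v` exist, and all of
them end in `P v`. -/
def IsParallelTransport (γ : ℝ → M)
    (P : TangentSpace I (γ 0) ≃L[ℝ] TangentSpace I (γ 1)) : Prop :=
  ∀ (v : TangentSpace I (γ 0)) (w : TangentSpace I (γ 1)),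
    (∃ V : Π t : ℝ, TangentSpace I (γ t), IsParallelAlong I γ V ∧ V 0 = v ∧ V 1 = w) ↔ P v = w

end Parallel

end RiemGeom

end

/-!
The condition `∇ J = 0` for a field of endomorphisms `J` says in a chart that `J` solves a total
differential equation `D_v j = A v j`, with coefficients given by the Christoffel symbols, which are
analytic because the metric is (`isParallelEndAt_iff`). A solution is determined by its value at one
point. A germ of a solution at a point `a` is continued by solving the equation along the rays from
`a`. The result depends analytically on the end point of the ray, and therefore solves the total
equation on a whole ball by the identity theorem. The radius of this ball is bounded below near
every point (`exists_ball_forall_extension`). Hence parallel fields of endomorphisms form a locally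
constant sheaf (`isLocallyConstant_isParallelEndAt`), whose étalé space is a covering space of `M`
(`Etale.isCoveringMap`).

A parallel field `J_U` over an open connected set `U` gives a section of the covering over `U`. If
`π₁(U) → π₁(M)` is surjective, then so is the map on fundamental groups induced by the covering
map, with the germ of `J_U` as base point, because it is surjective on the image of the section. By
the lifting criterion the covering has a global section through this germ
(`IsLocallyConstantSheaf.exists_extension`). For the resulting field `J`, the parallel fields
`J ∘ J` and `-1` agree on `U`, hence everywhere, and the Nijenhuis tensor vanishes because `∇` is
torsion-free (`isParallelComplexStructureOn_univ`).

Parallel transport exists along piecewise smooth paths because it is given in charts by a linear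
ordinary differential equation (`hasTransport_of_isPiecewiseSmoothPath`). If `V` is parallel along a
path then so is `J V` (`IsParallelOn.map_end`), which gives the formula for `J` in terms of parallel
transport.
-/

noncomputable section

set_option maxSynthPendingDepth 3

namespace RiemGeom

/-! ### Charts and vector fields -/

section Coordinates

variable {E : Type*} [NormedAddCommGroup E] [NormedSpace ℝ E]
  {H : Type*} [TopologicalSpace H] (I : ModelWithCorners ℝ E H)
  {M : Type*} [TopologicalSpace M] [ChartedSpace H M] [IsManifold I ω M]

/-- The coordinates of a tangent vector at `x` in the chart at `q`. For `x` in the domain of the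
chart this is the differential of the chart; elsewhere the value is `0`. -/
def toCoord (q x : M) : TangentSpace I x →L[ℝ] E :=
  (trivializationAt E (TangentSpace I : M → Type _) q).continuousLinearMapAt ℝ x

/-- The tangent vector at `x` with given coordinates in the chart at `q`. For fixed `v`, the vector
field `fun x ↦ ofCoord I q x v` is the coordinate field with constant coefficients `v`. -/
def ofCoord (q x : M) : E →L[ℝ] TangentSpace I x :=
  (trivializationAt E (TangentSpace I : M → Type _) q).symmL ℝ x

variable {I}

theorem toCoord_ofCoord {q x : M} (hx : x ∈ (chartAt H q).source) (v : E) :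
    toCoord I q x (ofCoord I q x v) = v := by
  have hx' : x ∈ (trivializationAt E (TangentSpace I : M → Type _) q).baseSet := hx
  exact (trivializationAt E (TangentSpace I : M → Type _) q).continuousLinearMapAt_symmL hx' v

theorem ofCoord_toCoord {q x : M} (hx : x ∈ (chartAt H q).source) (v : TangentSpace I x) :
    ofCoord I q x (toCoord I q x v) = v := by
  have hx' : x ∈ (trivializationAt E (TangentSpace I : M → Type _) q).baseSet := hx
  exact (trivializationAt E (TangentSpace I : M → Type _) q).symmL_continuousLinearMapAt hx' v

theorem toCoord_apply {q x : M} (hx : x ∈ (chartAt H q).source) (v : TangentSpace I x) :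
    toCoord I q x v = (trivializationAt E (TangentSpace I : M → Type _) q ⟨x, v⟩).2 := by
  have hx' : x ∈ (trivializationAt E (TangentSpace I : M → Type _) q).baseSet := hx
  simp [toCoord, (trivializationAt E (TangentSpace I : M → Type _) q).coe_linearMapAt_of_mem hx']

theorem ofCoord_apply {q x : M} (hx : x ∈ (chartAt H q).source) (v : E) :
    ofCoord I q x v = (trivializationAt E (TangentSpace I : M → Type _) q).symm x v :=
  (trivializationAt E (TangentSpace I : M → Type _) q).symmL_apply (R := ℝ) hx v

theorem toCoord_eq_mfderiv {q x : M} (hx : x ∈ (chartAt H q).source) :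
    toCoord I q x = mfderiv I 𝓘(ℝ, E) (extChartAt I q) x :=
  TangentBundle.continuousLinearMapAt_trivializationAt hx

theorem eventually_chart_source {q x : M} (hx : x ∈ (chartAt H q).source) :
    ∀ᶠ y in 𝓝 x, y ∈ (chartAt H q).source :=
  (chartAt H q).open_source.mem_nhds hx

theorem contMDiffAt_section_iff {k : ℕ∞ω} {q x : M} (hx : x ∈ (chartAt H q).source)
    {Y : Π x : M, TangentSpace I x} :
    ContMDiffAt I I.tangent k (fun y ↦ (⟨y, Y y⟩ : TangentBundle I M)) x ↔
      ContMDiffAt I 𝓘(ℝ, E) k (fun y ↦ toCoord I q y (Y y)) x := by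
  have hx' : x ∈ (trivializationAt E (TangentSpace I : M → Type _) q).baseSet := hx
  have : ContMDiffVectorBundle k E (TangentSpace I : M → Type _) I :=
    ContMDiffVectorBundle.of_le (n := ω) le_top
  refine ((trivializationAt E (TangentSpace I : M → Type _) q).contMDiffAt_section_iff hx').trans
    (Filter.EventuallyEq.contMDiffAt_iff ?_)
  filter_upwards [eventually_chart_source hx] with y hy using (toCoord_apply hy _).symm

theorem mdifferentiableAt_section_iff {q x : M} (hx : x ∈ (chartAt H q).source)
    {Y : Π x : M, TangentSpace I x} :
    MDiffAt (T% Y) x ↔ MDiffAt (fun y ↦ toCoord I q y (Y y)) x := by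
  have hx' : x ∈ (trivializationAt E (TangentSpace I : M → Type _) q).baseSet := hx
  refine ((trivializationAt E (TangentSpace I : M → Type _) q).mdifferentiableAt_section_iff
    I _ hx').trans (Filter.EventuallyEq.mdifferentiableAt_iff ?_)
  filter_upwards [eventually_chart_source hx] with y hy using (toCoord_apply hy _).symm

theorem contMDiffAt_ofCoord {k : ℕ∞ω} {q x : M} (hx : x ∈ (chartAt H q).source) {f : M → E}
    (hf : ContMDiffAt I 𝓘(ℝ, E) k f x) :
    ContMDiffAt I I.tangent k (fun y ↦ (⟨y, ofCoord I q y (f y)⟩ : TangentBundle I M)) x := by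
  refine (contMDiffAt_section_iff hx).2 (hf.congr_of_eventuallyEq ?_)
  filter_upwards [eventually_chart_source hx] with y hy using toCoord_ofCoord hy _

theorem mdifferentiableAt_ofCoord {q x : M} (hx : x ∈ (chartAt H q).source) {f : M → E}
    (hf : MDiffAt f x) : MDiffAt (T% (fun y ↦ ofCoord I q y (f y))) x := by
  refine (mdifferentiableAt_section_iff hx).2 (hf.congr_of_eventuallyEq ?_)
  filter_upwards [eventually_chart_source hx] with y hy using toCoord_ofCoord hy _

theorem mdifferentiableAt_ofCoord_const {q x : M} (hx : x ∈ (chartAt H q).source) (v : E) :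
    MDiffAt (T% (fun y ↦ ofCoord I q y v)) x :=
  mdifferentiableAt_ofCoord hx mdifferentiableAt_const

theorem differentiableAt_comp_symm [I.Boundaryless] {F : Type*} [NormedAddCommGroup F]
    [NormedSpace ℝ F] {f : M → F} {q x : M} (hx : x ∈ (chartAt H q).source) (hf : MDiffAt f x) :
    DifferentiableAt ℝ (f ∘ (extChartAt I q).symm) (extChartAt I q x) := by
  have hxs : x ∈ (extChartAt I q).source := by rwa [extChartAt_source]
  have h2 : MDifferentiableAt 𝓘(ℝ, E) I (extChartAt I q).symm (extChartAt I q x) := by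
    have := mdifferentiableWithinAt_extChartAt_symm (I := I) (x := q) (z := extChartAt I q x)
      ((extChartAt I q).map_source hxs)
    rwa [I.range_eq_univ, mdifferentiableWithinAt_univ] at this
  rw [← mdifferentiableAt_iff_differentiableAt]
  refine MDifferentiableAt.comp (I' := I) _ ?_ h2
  rwa [(extChartAt I q).left_inv hxs]

theorem mvfderiv_eq_fderiv [I.Boundaryless] {F : Type*} [NormedAddCommGroup F] [NormedSpace ℝ F]
    {f : M → F} {q x : M} (hx : x ∈ (chartAt H q).source) (hf : MDiffAt f x)
    (ξ : TangentSpace I x) :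
    mvfderiv I f x ξ =
      fderiv ℝ (f ∘ (extChartAt I q).symm) (extChartAt I q x) (toCoord I q x ξ) := by
  have h1 := (differentiableAt_comp_symm hx hf).mdifferentiableAt
  have h3 : mfderiv I 𝓘(ℝ, F) f x =
      mfderiv I 𝓘(ℝ, F) ((f ∘ (extChartAt I q).symm) ∘ extChartAt I q) x := by
    refine Filter.EventuallyEq.mfderiv_eq ?_
    filter_upwards [eventually_chart_source hx] with y hy
    exact congrArg f ((extChartAt I q).left_inv (by rwa [extChartAt_source])).symm
  have h4 := mfderiv_comp x h1 (mdifferentiableAt_extChartAt hx)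
  rw [← toCoord_eq_mfderiv hx, mfderiv_eq_fderiv] at h4
  rw [mvfderiv, h3, h4]
  rfl

theorem mlieBracket_ofCoord_const [CompleteSpace E] [I.Boundaryless] {q x : M}
    (hx : x ∈ (chartAt H q).source) (v w : E) :
    mlieBracket I (fun y ↦ ofCoord I q y v) (fun y ↦ ofCoord I q y w) x = 0 := by
  have key : ∀ u : E, (fun y ↦ ofCoord I q y u) =ᶠ[𝓝 x]
      mpullback I 𝓘(ℝ, E) (extChartAt I q) (fun _ ↦ u) := by
    intro u
    filter_upwards [eventually_chart_source hx] with y hy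
    change ofCoord I q y u = (mfderiv I 𝓘(ℝ, E) (extChartAt I q) y).inverse u
    rw [← toCoord_eq_mfderiv hy]
    have e : (toCoord I q y).inverse = ofCoord I q y :=
      ContinuousLinearMap.inverse_eq (ContinuousLinearMap.ext (toCoord_ofCoord hy))
        (ContinuousLinearMap.ext (ofCoord_toCoord hy))
    exact congrArg (fun L ↦ L u) e.symm
  have hc : ∀ u : E, MDifferentiableAt 𝓘(ℝ, E) 𝓘(ℝ, E).tangent
      (fun y : E ↦ (⟨y, u⟩ : TangentBundle 𝓘(ℝ, E) E)) (extChartAt I q x) := fun u ↦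
    ((contMDiffAt_vectorSpace_iff_contDiffAt (n := 1) (V := fun _ ↦ u)).2
      contDiffAt_const).mdifferentiableAt one_ne_zero
  rw [(key v).mlieBracket_vectorField_eq (key w), ← mpullback_mlieBracket (n := ω) (hc v) (hc w)
    (contMDiffAt_extChartAt' hx) (by simp)]
  have h0 : mlieBracket 𝓘(ℝ, E) (fun _ : E ↦ v) (fun _ ↦ w) = 0 := by
    have h1 : ∀ V W : Π x : E, TangentSpace 𝓘(ℝ, E) x,
        mlieBracket 𝓘(ℝ, E) V W = lieBracket ℝ V W := fun V W ↦ by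
      rw [← mlieBracketWithin_univ, mlieBracketWithin_eq_lieBracketWithin]
      exact lieBracketWithin_univ (𝕜 := ℝ) (V := V) (W := W)
    refine (h1 _ _).trans ?_
    ext z
    simp only [lieBracket, fderiv_const_apply, zero_apply, sub_zero]
    rfl
  rw [h0]
  simp [mpullback_apply]

end Coordinates

/-! ### The Levi-Civita connection in a chart -/

section Christoffel

variable {E : Type*} [NormedAddCommGroup E] [NormedSpace ℝ E]
  {H : Type*} [TopologicalSpace H] (I : ModelWithCorners ℝ E H)
  {M : Type*} [TopologicalSpace M] [ChartedSpace H M] [IsManifold I ω M]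
  [RiemannianBundle (fun x : M ↦ TangentSpace I x)]

/-- The metric in the chart at `q`, as a function of the coordinates `z`. -/
def gram (q : M) (z : E) : E →L[ℝ] E →L[ℝ] ℝ :=
  (innerSL ℝ (E := TangentSpace I ((extChartAt I q).symm z))).bilinearComp
    (ofCoord I q ((extChartAt I q).symm z)) (ofCoord I q ((extChartAt I q).symm z))

/-- The trilinear form `D_u g (v, w) + D_v g (u, w) - D_w g (u, v)` of first derivatives of the
metric, which is the Koszul formula for coordinate fields, as their brackets vanish. -/
def gramDeriv (q : M) (z : E) : E →L[ℝ] E →L[ℝ] E →L[ℝ] ℝ :=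
  fderiv ℝ (gram I q) z + (fderiv ℝ (gram I q) z).flip
    - ((ContinuousLinearMap.flipₗᵢ ℝ E E ℝ).toContinuousLinearEquiv.toContinuousLinearMap ∘L
        (fderiv ℝ (gram I q) z).flip)

/-- The Christoffel symbols in the chart at `q`, obtained from `gramDeriv` by raising an index. -/
def christoffel (q : M) (z : E) : E →L[ℝ] E →L[ℝ] E :=
  (1 / 2 : ℝ) • (ContinuousLinearMap.compL ℝ E (E →L[ℝ] ℝ) E (gram I q z).inverse ∘L
    gramDeriv I q z)

variable {I}

theorem gram_apply (q : M) (z v w : E) : gram I q z v w =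
    inner ℝ (ofCoord I q ((extChartAt I q).symm z) v) (ofCoord I q ((extChartAt I q).symm z) w) :=
  rfl

theorem gram_extChartAt {q x : M} (hx : x ∈ (chartAt H q).source) (v w : E) :
    gram I q (extChartAt I q x) v w = inner ℝ (ofCoord I q x v) (ofCoord I q x w) := by
  rw [gram_apply, (extChartAt I q).left_inv (by rwa [extChartAt_source])]

theorem gramDeriv_apply (q : M) (z u v w : E) :
    gramDeriv I q z u v w = fderiv ℝ (gram I q) z u v w + fderiv ℝ (gram I q) z v u w
      - fderiv ℝ (gram I q) z w u v := by
  simp [gramDeriv]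

omit [RiemannianBundle (fun x : M ↦ TangentSpace I x)] in
theorem contMDiffAt_iff_contDiffAt_comp_symm [I.Boundaryless] {F : Type*} [NormedAddCommGroup F]
    [NormedSpace ℝ F] {k : ℕ∞ω} {f : M → F} {q x : M} (hx : x ∈ (chartAt H q).source) :
    ContMDiffAt I 𝓘(ℝ, F) k f x ↔
      ContDiffAt ℝ k (f ∘ (extChartAt I q).symm) (extChartAt I q x) := by
  have : IsManifold I k M := .of_le (n := ω) le_top
  rw [contMDiffAt_iff_source_of_mem_source hx, I.range_eq_univ, contMDiffWithinAt_univ,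
    contMDiffAt_iff_contDiffAt]

variable [FiniteDimensional ℝ E] [IsContMDiffRiemannianBundle I ω E (fun x : M ↦ TangentSpace I x)]

theorem contDiffOn_gram [I.Boundaryless] (q : M) :
    ContDiffOn ℝ ω (gram I q) (extChartAt I q).target := by
  rw [contDiffOn_clm_apply]
  intro v
  rw [contDiffOn_clm_apply]
  intro w z hz
  refine ContDiffAt.contDiffWithinAt ?_
  have hx : (extChartAt I q).symm z ∈ (chartAt H q).source := by
    simpa using (extChartAt I q).map_target hz
  have h1 := fun u : E ↦ contMDiffAt_ofCoord (I := I) (k := ω) hx (contMDiffAt_const (c := u))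
  have h2 : ContMDiffAt I 𝓘(ℝ) ω (fun y ↦ inner ℝ (ofCoord I q y v) (ofCoord I q y w))
      ((extChartAt I q).symm z) := by
    exact ContMDiffAt.inner_bundle (IB := I) (F := E) (E := fun x : M ↦ TangentSpace I x) (b := id)
      (h1 v) (h1 w)
  have h3 := (contMDiffAt_iff_contDiffAt_comp_symm hx).1 h2
  rwa [(extChartAt I q).right_inv hz] at h3

omit [IsContMDiffRiemannianBundle I ω E (fun x : M ↦ TangentSpace I x)] in
theorem gram_isInvertible (q : M) {z : E} (hz : z ∈ (extChartAt I q).target) :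
    (gram I q z).IsInvertible := by
  have hx : (extChartAt I q).symm z ∈ (chartAt H q).source := by
    simpa using (extChartAt I q).map_target hz
  have hinj : Function.Injective (gram I q z) := by
    refine (injective_iff_map_eq_zero _).2 fun v hv ↦ ?_
    have : gram I q z v v = 0 := by simp [hv]
    rw [gram_apply, inner_self_eq_zero] at this
    rw [← toCoord_ofCoord (I := I) hx v, this, map_zero]
  have hfin : Module.finrank ℝ E = Module.finrank ℝ (E →L[ℝ] ℝ) := by
    rw [← (LinearMap.toContinuousLinearMap (𝕜 := ℝ) (E := E) (F' := ℝ)).finrank_eq]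
    exact (Subspace.dual_finrank_eq (K := ℝ) (V := E)).symm
  refine ⟨(LinearEquiv.ofInjectiveOfFinrankEq (gram I q z).toLinearMap hinj
    hfin).toContinuousLinearEquiv, ?_⟩
  ext v w
  rfl

theorem contDiffOn_christoffel [I.Boundaryless] (q : M) :
    ContDiffOn ℝ ω (christoffel I q) (extChartAt I q).target := by
  have : CompleteSpace E := FiniteDimensional.complete ℝ E
  have ho : IsOpen (extChartAt I q).target := isOpen_extChartAt_target q
  have hd : ContDiffOn ℝ ω (fderiv ℝ (gram I q)) (extChartAt I q).target :=
    (contDiffOn_gram q).fderiv_of_isOpen ho (by simp)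
  have hf : ContDiffOn ℝ ω (fun z ↦ (fderiv ℝ (gram I q) z).flip) (extChartAt I q).target :=
    (ContinuousLinearMap.flipₗᵢ ℝ E E (E →L[ℝ] ℝ)).contDiff.comp_contDiffOn hd
  have hK : ContDiffOn ℝ ω (gramDeriv I q) (extChartAt I q).target :=
    (hd.add hf).sub (contDiffOn_const.clm_comp hf)
  have hi : ContDiffOn ℝ ω (fun z ↦ (gram I q z).inverse) (extChartAt I q).target := by
    intro z hz
    obtain ⟨e, he⟩ := gram_isInvertible q hz
    have h1 : ContDiffAt ℝ ω (ContinuousLinearMap.inverse : (E →L[ℝ] E →L[ℝ] ℝ) → _)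
        (gram I q z) := by
      rw [← he]
      exact contDiffAt_map_inverse e
    exact h1.comp_contDiffWithinAt z (contDiffOn_gram q z hz)
  have hc : ContDiffOn ℝ ω (fun z ↦ ContinuousLinearMap.compL ℝ E (E →L[ℝ] ℝ) E
      (gram I q z).inverse) (extChartAt I q).target :=
    (ContinuousLinearMap.compL ℝ E (E →L[ℝ] ℝ) E).contDiff.comp_contDiffOn hi
  exact (hc.clm_comp hK).const_smul (1 / 2 : ℝ)

omit [FiniteDimensional ℝ E]
  [IsContMDiffRiemannianBundle I ω E (fun x : M ↦ TangentSpace I x)] in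
theorem gram_christoffel [FiniteDimensional ℝ E] (q : M) {z : E}
    (hz : z ∈ (extChartAt I q).target) (u v w : E) :
    2 * gram I q z (christoffel I q z u v) w = gramDeriv I q z u v w := by
  obtain ⟨e, he⟩ := gram_isInvertible (I := I) q hz
  have : gram I q z ((gram I q z).inverse (gramDeriv I q z u v)) = gramDeriv I q z u v := by
    rw [← he, ContinuousLinearMap.inverse_equiv]
    exact e.apply_symm_apply _
  simp [christoffel, this]

theorem mvfderiv_inner_ofCoord [I.Boundaryless] {q x : M} (hx : x ∈ (chartAt H q).source)
    (u v w : E) :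
    mvfderiv I (fun y ↦ inner ℝ (ofCoord I q y v) (ofCoord I q y w)) x (ofCoord I q x u) =
      fderiv ℝ (gram I q) (extChartAt I q x) u v w := by
  have h1 := mdifferentiableAt_ofCoord_const (I := I) hx
  have hz : extChartAt I q x ∈ (extChartAt I q).target :=
    (extChartAt I q).map_source (by rwa [extChartAt_source])
  have hd : DifferentiableAt ℝ (gram I q) (extChartAt I q x) :=
    ((contDiffOn_gram q).contDiffAt ((isOpen_extChartAt_target q).mem_nhds hz)).differentiableAt
      (by simp)
  rw [mvfderiv_eq_fderiv hx (mdiffAt_inner (h1 v) (h1 w)), toCoord_ofCoord hx]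
  change fderiv ℝ (fun z ↦ gram I q z v w) (extChartAt I q x) u = _
  rw [fderiv_clm_apply (hd.clm_apply (differentiableAt_const v)) (differentiableAt_const w),
    fderiv_clm_apply hd (differentiableAt_const v)]
  simp

theorem leviCivita_ofCoord_const [I.Boundaryless] {q x : M} (hx : x ∈ (chartAt H q).source)
    (u v : E) :
    leviCivita I M (fun y ↦ ofCoord I q y v) x (ofCoord I q x u) =
      ofCoord I q x (christoffel I q (extChartAt I q x) u v) := by
  have : CompleteSpace E := FiniteDimensional.complete ℝ E
  have h1 := mdifferentiableAt_ofCoord_const (I := I) hx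
  have hz : extChartAt I q x ∈ (extChartAt I q).target :=
    (extChartAt I q).map_source (by rwa [extChartAt_source])
  refine ext_inner_right ℝ fun w ↦ ?_
  rw [← ofCoord_toCoord hx w, ← gram_extChartAt hx]
  have h2 := gram_christoffel (I := I) q hz u v (toCoord I q x w)
  have h3 := inner_leviCivitaFun (h1 u) (h1 v) (h1 (toCoord I q x w))
  change 2 * inner ℝ (leviCivita I M (fun y ↦ ofCoord I q y v) x (ofCoord I q x u)) _ = _ at h3
  rw [koszul, mvfderiv_inner_ofCoord hx, mvfderiv_inner_ofCoord hx, mvfderiv_inner_ofCoord hx,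
    mlieBracket_ofCoord_const hx, mlieBracket_ofCoord_const hx, mlieBracket_ofCoord_const hx] at h3
  rw [gramDeriv_apply] at h2
  simp only [inner_zero_left, add_zero, sub_zero] at h3
  linarith

variable (I) in
/-- The flat connection in the chart at `q`, which differentiates the coordinates of a vector field.
The difference of `leviCivita` and this connection is a tensor, so that it can be computed on
coordinate fields. -/
def flatConnection (q : M) (Y : Π x : M, TangentSpace I x) (x : M) :
    TangentSpace I x →L[ℝ] TangentSpace I x :=
  ofCoord I q x ∘L mvfderiv I (fun y ↦ toCoord I q y (Y y)) x

omit [FiniteDimensional ℝ E] [RiemannianBundle (fun x : M ↦ TangentSpace I x)]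
  [IsContMDiffRiemannianBundle I ω E (fun x : M ↦ TangentSpace I x)] in
theorem isCovariantDerivativeOn_flatConnection (q : M) :
    IsCovariantDerivativeOn E (flatConnection I q) (chartAt H q).source where
  add {Y Y' x} hY hY' hx := by
    rw [mdifferentiableAt_section_iff hx] at hY hY'
    have e : (fun y ↦ toCoord I q y ((Y + Y') y)) =
        fun y ↦ toCoord I q y (Y y) + toCoord I q y (Y' y) := by
      ext y; exact map_add _ _ _
    rw [flatConnection, e, mvfderiv_fun_add hY hY', ContinuousLinearMap.comp_add]
    rfl
  leibniz {Y f x} hY hf hx := by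
    rw [mdifferentiableAt_section_iff hx] at hY
    have e : (fun y ↦ toCoord I q y ((f • Y) y)) =
        f • fun y ↦ toCoord I q y (Y y) := by
      ext y; exact map_smul _ _ _
    rw [flatConnection, e, mvfderiv_smul hf hY]
    ext v
    change ofCoord I q x (f x • mvfderiv I (fun y ↦ toCoord I q y (Y y)) x v
      + mvfderiv I f x v • toCoord I q x (Y x)) = f x • ofCoord I q x
        (mvfderiv I (fun y ↦ toCoord I q y (Y y)) x v) + mvfderiv I f x v • Y x
    rw [map_add, map_smul, map_smul, ofCoord_toCoord hx]

/-- `∇_ξ Y = dY(ξ) + Γ(ξ, Y)` in the chart at `q`. -/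
theorem leviCivita_eq [I.Boundaryless] {q x : M} (hx : x ∈ (chartAt H q).source)
    {Y : Π x : M, TangentSpace I x} (hY : MDiffAt (T% Y) x) (ξ : TangentSpace I x) :
    toCoord I q x (leviCivita I M Y x ξ) = mvfderiv I (fun y ↦ toCoord I q y (Y y)) x ξ +
      christoffel I q (extChartAt I q x) (toCoord I q x ξ) (toCoord I q x (Y x)) := by
  have hL := (leviCivita I M).isCovariantDerivativeOn (s := (chartAt H q).source)
  have hF := isCovariantDerivativeOn_flatConnection (I := I) q
  set v := toCoord I q x (Y x) with hv
  have h1 := mdifferentiableAt_ofCoord_const (I := I) hx v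
  have d1 := IsCovariantDerivativeOn.difference_apply hL hF hx hY
  have d2 := IsCovariantDerivativeOn.difference_apply hL hF hx h1
  have e1 : ofCoord I q x v = Y x := ofCoord_toCoord hx _
  rw [e1, d1] at d2
  have d3 := congrArg (fun L ↦ toCoord I q x (L ξ)) d2
  have e2 : flatConnection I q (fun y ↦ ofCoord I q y v) x ξ = 0 := by
    have e : (fun y ↦ toCoord I q y (ofCoord I q y v)) =ᶠ[𝓝 x] fun _ ↦ v := by
      filter_upwards [eventually_chart_source hx] with y hy using toCoord_ofCoord hy v
    have e' : mvfderiv I (fun y ↦ toCoord I q y (ofCoord I q y v)) x = 0 := by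
      rw [mvfderiv, e.mfderiv_eq, mfderiv_const]
      rfl
    rw [flatConnection, e', ContinuousLinearMap.comp_zero]
    rfl
  have e3 := leviCivita_ofCoord_const (I := I) hx (toCoord I q x ξ) v
  rw [ofCoord_toCoord hx] at e3
  simp only [sub_apply, map_sub, e2, e3, toCoord_ofCoord hx, sub_zero] at d3
  rw [flatConnection, ContinuousLinearMap.comp_apply, toCoord_ofCoord hx, sub_eq_iff_eq_add] at d3
  rw [d3, add_comm]
end Christoffel

/-! ### Total differential equations with analytic coefficients -/

section AnalyticTransport

open unitInterval

variable {E : Type*} [NormedAddCommGroup E] [NormedSpace ℝ E]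
  {F : Type*} [NormedAddCommGroup F] [NormedSpace ℝ F]
  {W : Type*} [NormedAddCommGroup W] [NormedSpace ℝ W]

variable (E F) in
/-- Pointwise application of a continuous family of operators on `[0, 1]` to a continuous function
on `[0, 1]`, as a continuous bilinear map. -/
def pointwiseApply : C(I, E →L[ℝ] F) →L[ℝ] C(I, E) →L[ℝ] C(I, F) :=
  LinearMap.mkContinuous₂
    (LinearMap.mk₂ ℝ (fun (B : C(I, E →L[ℝ] F)) (y : C(I, E)) ↦
        (⟨fun s ↦ B s (y s), by fun_prop⟩ : C(I, F)))
      (fun _ _ _ ↦ by ext; simp) (fun _ _ _ ↦ by ext; simp)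
      (fun _ _ _ ↦ by ext; simp) (fun _ _ _ ↦ by ext; simp)) 1 <| by
    intro B y
    refine (ContinuousMap.norm_le _ (by positivity)).2 fun s ↦ ?_
    rw [one_mul]
    exact (B s).le_of_opNorm_le_of_le (B.norm_coe_le_norm s) (y.norm_coe_le_norm s)

@[simp]
theorem pointwiseApply_apply (B : C(I, E →L[ℝ] F)) (y : C(I, E)) (s : I) :
    pointwiseApply E F B y s = B s (y s) := rfl

theorem norm_pointwiseApply_le (B : C(I, E →L[ℝ] F)) : ‖pointwiseApply E F B‖ ≤ ‖B‖ := by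
  refine ContinuousLinearMap.opNorm_le_bound _ (norm_nonneg _) fun y ↦ ?_
  refine (ContinuousMap.norm_le _ (by positivity)).2 fun s ↦ ?_
  exact (B s).le_of_opNorm_le_of_le (B.norm_coe_le_norm s) (y.norm_coe_le_norm s)

omit [NormedSpace ℝ W] in
theorem continuous_comp_projIcc (y : C(I, W)) :
    Continuous fun s : ℝ ↦ y (Set.projIcc 0 1 zero_le_one s) :=
  y.continuous.comp continuous_projIcc

variable (W) in
/-- The Volterra operator `y ↦ (t ↦ ∫ s in 0..t, y s)` on `C([0, 1], W)`. -/
def volterra : C(I, W) →L[ℝ] C(I, W) :=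
  LinearMap.mkContinuous
    { toFun := fun y ↦ ⟨fun t ↦ ∫ s in (0 : ℝ)..t, y (Set.projIcc 0 1 zero_le_one s),
        (intervalIntegral.continuous_primitive
          (fun _ _ ↦ (continuous_comp_projIcc y).intervalIntegrable _ _) 0).comp
          continuous_subtype_val⟩
      map_add' := fun y y' ↦ by
        ext t
        exact intervalIntegral.integral_add ((continuous_comp_projIcc y).intervalIntegrable _ _)
          ((continuous_comp_projIcc y').intervalIntegrable _ _)
      map_smul' := fun c y ↦ by
        ext t
        exact intervalIntegral.integral_smul c _ } 1 <| by
    intro y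
    refine (ContinuousMap.norm_le _ (by positivity)).2 fun t ↦ ?_
    have := intervalIntegral.norm_integral_le_of_norm_le_const (a := 0) (b := (t : ℝ)) (C := ‖y‖)
      (f := fun s ↦ y (Set.projIcc 0 1 zero_le_one s)) fun s _ ↦ y.norm_coe_le_norm _
    refine this.trans ?_
    rw [sub_zero, abs_of_nonneg t.2.1, mul_comm]
    exact mul_le_mul_of_nonneg_right t.2.2 (norm_nonneg _)

theorem norm_volterra_le : ‖volterra W‖ ≤ 1 :=
  LinearMap.mkContinuous_norm_le _ zero_le_one _

variable (W) in
/-- Multiplication by `s ^ k`, from `W` to `C([0, 1], W)`. -/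
def powSmul (k : ℕ) : W →L[ℝ] C(I, W) :=
  LinearMap.mkContinuous
    { toFun := fun w ↦ ⟨fun s ↦ (s : ℝ) ^ k • w, by fun_prop⟩
      map_add' := fun w w' ↦ by ext; simp
      map_smul' := fun c w ↦ by ext; simp [smul_comm c] } 1 <| by
    intro w
    refine (ContinuousMap.norm_le _ (by positivity)).2 fun s ↦ ?_
    change ‖(s : ℝ) ^ k • w‖ ≤ _
    rw [norm_smul, norm_pow, Real.norm_of_nonneg s.2.1]
    exact mul_le_mul_of_nonneg_right (pow_le_one₀ s.2.1 s.2.2) (norm_nonneg _)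

theorem powSmul_apply (k : ℕ) (w : W) (s : I) : powSmul W k w s = (s : ℝ) ^ k • w := rfl

theorem norm_powSmul_le (k : ℕ) : ‖powSmul W k‖ ≤ 1 :=
  LinearMap.mkContinuous_norm_le _ zero_le_one _

/-- If `p` is the power series of `f` at `a`, this is the power series of the map that sends `z` to
the restriction `s ↦ f (a + s z)` of `f` to the ray in direction `z`. -/
def raySeries (p : FormalMultilinearSeries ℝ E W) : FormalMultilinearSeries ℝ E C(I, W) :=
  fun k ↦ (powSmul W k).compContinuousMultilinearMap (p k)

theorem radius_le_radius_raySeries (p : FormalMultilinearSeries ℝ E W) :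
    p.radius ≤ (raySeries p).radius := by
  refine FormalMultilinearSeries.radius_le_of_le fun k ↦ ?_
  refine (ContinuousLinearMap.norm_compContinuousMultilinearMap_le _ _).trans ?_
  exact mul_le_of_le_one_left (norm_nonneg _) (norm_powSmul_le k)

variable {f : E → W} {p : FormalMultilinearSeries ℝ E W} {a : E} {r : ENNReal}

theorem raySeries_sum_apply [CompleteSpace W] (hf : HasFPowerSeriesOnBall f p a r) {z : E}
    (hz : z ∈ Metric.eball 0 r) (s : I) :
    (raySeries p).sum z s = f (a + (s : ℝ) • z) := by
  have hs : ‖(s : ℝ)‖ₑ ≤ 1 := by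
    rw [Real.enorm_of_nonneg s.2.1, ENNReal.ofReal_le_one]
    exact s.2.2
  have h1 := (raySeries p).hasSum (Metric.eball_subset_eball
    (hf.r_le.trans (radius_le_radius_raySeries p)) hz)
  have h2 := (ContinuousMap.evalCLM ℝ s).hasSum h1
  have hsz : (s : ℝ) • z ∈ Metric.eball (0 : E) r := by
    rw [mem_eball_zero_iff] at hz ⊢
    refine lt_of_le_of_lt ?_ hz
    rw [enorm_smul]
    exact mul_le_of_le_one_left zero_le hs
  have h3 := hf.hasSum hsz
  refine h2.unique ?_
  convert! h3 using 2 with k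
  have := (p k).map_smul_univ (fun _ ↦ (s : ℝ)) (fun _ ↦ z)
  rw [Fin.prod_const] at this
  exact this.symm

theorem analyticOnNhd_raySeries_sum [CompleteSpace W] (hf : HasFPowerSeriesOnBall f p a r) :
    AnalyticOnNhd ℝ (raySeries p).sum (Metric.eball 0 r) := by
  have h := hf.r_le.trans (radius_le_radius_raySeries p)
  exact ((raySeries p).hasFPowerSeriesOnBall (hf.r_pos.trans_le h)).analyticOnNhd.mono
    (Metric.eball_subset_eball h)

section Ode

variable (A : E → E →L[ℝ] W →L[ℝ] W)

/-- `j` solves the total differential equation `D_v j (z) = A z v (j z)` on `S`. -/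
def SolvesOn (j : E → W) (S : Set E) : Prop :=
  ∀ z ∈ S, HasFDerivAt j ((A z).flip (j z)) z

/-- The operator `y ↦ (t ↦ ∫ s in 0..t, A (a + s z) z (y s))`, if `p` is the power series of `A` at
`a`. Restricting a solution of `SolvesOn A` to the ray in direction `z` gives a solution `y` of the
integral equation `y = y 0 + rayOperator p z y`. -/
def rayOperator (p : FormalMultilinearSeries ℝ E (E →L[ℝ] W →L[ℝ] W)) (z : E) :
    C(I, W) →L[ℝ] C(I, W) :=
  volterra W ∘L pointwiseApply W W
    (pointwiseApply E (W →L[ℝ] W) ((raySeries p).sum z) (powSmul E 0 z))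

/-- The value at time `1` of the solution with initial value `w` of the ordinary differential
equation along the ray in direction `z`, that is of the integral equation
`y = w + rayOperator p z y`. It is `0` (a junk value) if `1 - rayOperator p z` is not invertible. -/
def raySolution (p : FormalMultilinearSeries ℝ E (E →L[ℝ] W →L[ℝ] W)) (w : W) (z : E) : W :=
  Ring.inverse (1 - rayOperator p z) (powSmul W 0 w) 1

variable {A} [CompleteSpace W] {p : FormalMultilinearSeries ℝ E (E →L[ℝ] W →L[ℝ] W)} {a : E}
  {ρ C : ℝ}

omit [NormedSpace ℝ E] in
theorem mem_eball_of_le {r : ENNReal} (hr : ENNReal.ofReal ρ ≤ r) {z : E}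
    (hz : z ∈ Metric.ball (0 : E) ρ) : z ∈ Metric.eball (0 : E) r := by
  rw [← Metric.eball_ofReal] at hz
  exact Metric.eball_subset_eball hr hz

theorem norm_rayOperator_lt_one (hf : HasFPowerSeriesOnBall A p a r)
    (hr : ENNReal.ofReal ρ ≤ r) (hA : ∀ z ∈ Metric.ball a ρ, ‖A z‖ ≤ C) (hC : C * ρ < 1)
    {z : E} (hz : z ∈ Metric.ball (0 : E) ρ) : ‖rayOperator p z‖ < 1 := by
  have hzρ : ‖z‖ < ρ := by simpa using hz
  have hC0 : 0 ≤ C :=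
    (norm_nonneg _).trans (hA a (Metric.mem_ball_self ((norm_nonneg z).trans_lt hzρ)))
  have h1 : ‖(raySeries p).sum z‖ ≤ C := by
    refine (ContinuousMap.norm_le _ hC0).2 fun s ↦ ?_
    rw [raySeries_sum_apply hf (mem_eball_of_le hr hz)]
    refine hA _ ?_
    rw [mem_ball_iff_norm, add_sub_cancel_left, norm_smul, Real.norm_of_nonneg s.2.1]
    exact (mul_le_of_le_one_left (norm_nonneg _) s.2.2).trans_lt hzρ
  have h2 : ‖powSmul E 0 z‖ ≤ ‖z‖ := by
    simpa using (powSmul E 0).le_of_opNorm_le (norm_powSmul_le 0) z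
  calc ‖rayOperator p z‖ ≤ 1 * (C * ‖z‖) := by
        refine (ContinuousLinearMap.opNorm_comp_le _ _).trans
          (mul_le_mul norm_volterra_le ?_ (norm_nonneg _) zero_le_one)
        refine (norm_pointwiseApply_le _).trans ?_
        exact ContinuousLinearMap.le_of_opNorm_le_of_le _ ((norm_pointwiseApply_le _).trans h1) h2
    _ ≤ C * ρ := by rw [one_mul]; gcongr
    _ < 1 := hC

theorem contDiffAt_raySolution (hf : HasFPowerSeriesOnBall A p a r)
    (hr : ENNReal.ofReal ρ ≤ r) (hA : ∀ z ∈ Metric.ball a ρ, ‖A z‖ ≤ C) (hC : C * ρ < 1)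
    {z : E} (hz : z ∈ Metric.ball (0 : E) ρ) (w : W) :
    ContDiffAt ℝ ω (raySolution p w) z := by
  have h1 : ContDiffAt ℝ ω (raySeries p).sum z :=
    ((analyticOnNhd_raySeries_sum hf) z (mem_eball_of_le hr hz)).contDiffAt
  have h2 : ContDiffAt ℝ ω (rayOperator p) z := by
    refine contDiffAt_const.clm_comp (ContDiffAt.clm_apply contDiffAt_const ?_)
    exact (contDiffAt_const.clm_apply h1).clm_apply (powSmul E 0).contDiff.contDiffAt
  obtain ⟨u, hu⟩ := isUnit_one_sub_of_norm_lt_one (norm_rayOperator_lt_one hf hr hA hC hz)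
  have h3 : ContDiffAt ℝ ω (Ring.inverse : (C(I, W) →L[ℝ] C(I, W)) → _) (1 - rayOperator p z) := by
    rw [← hu]; exact contDiffAt_ringInverse ℝ u
  have h4 : ContDiffAt ℝ ω (fun z ↦ Ring.inverse (1 - rayOperator p z)) z :=
    ContDiffAt.comp (g := Ring.inverse) (f := fun z ↦ 1 - rayOperator p z) z h3
      (contDiffAt_const.sub h2)
  exact (ContinuousMap.evalCLM ℝ (1 : I)).contDiff.contDiffAt.comp z
    (h4.clm_apply contDiffAt_const)

/-- A solution of the total differential equation is determined by its value at one point, since its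
restrictions to rays solve integral equations with a contracting operator. -/
theorem SolvesOn.eq_raySolution (hf : HasFPowerSeriesOnBall A p a r)
    (hr : ENNReal.ofReal ρ ≤ r) (hA : ∀ z ∈ Metric.ball a ρ, ‖A z‖ ≤ C) (hC : C * ρ < 1)
    {j : E → W} {ρ' : ℝ} (hj : SolvesOn A j (Metric.ball a ρ')) (hρ : ρ' ≤ ρ)
    {z : E} (hz : z ∈ Metric.ball (0 : E) ρ') : j (a + z) = raySolution p (j a) z := by
  have hzρ : z ∈ Metric.ball (0 : E) ρ := Metric.ball_subset_ball hρ hz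
  have hmem : ∀ s : I, a + (s : ℝ) • z ∈ Metric.ball a ρ' := fun s ↦ by
    rw [mem_ball_iff_norm, add_sub_cancel_left, norm_smul, Real.norm_of_nonneg s.2.1]
    exact (mul_le_of_le_one_left (norm_nonneg _) s.2.2).trans_lt (by simpa using hz)
  have hd : ∀ s : I, HasDerivAt (fun s : ℝ ↦ j (a + s • z))
      (A (a + (s : ℝ) • z) z (j (a + (s : ℝ) • z))) s := fun s ↦ by
    have h1 : HasDerivAt (fun s : ℝ ↦ a + s • z) z (s : ℝ) := by
      simpa using ((hasDerivAt_id (s : ℝ)).smul_const z).const_add a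
    exact (hj _ (hmem s)).comp_hasDerivAt (s : ℝ) h1
  let y : C(I, W) := ⟨fun s ↦ j (a + (s : ℝ) • z), continuous_iff_continuousAt.2 fun s ↦
    (hd s).continuousAt.comp continuous_subtype_val.continuousAt⟩
  have hy : (1 - rayOperator p z) y = powSmul W 0 (j a) := by
    ext t
    have key : ∫ s in (0 : ℝ)..t, (pointwiseApply W W (pointwiseApply E (W →L[ℝ] W)
        ((raySeries p).sum z) (powSmul E 0 z)) y) (Set.projIcc 0 1 zero_le_one s) =
        j (a + (t : ℝ) • z) - j (a + (0 : ℝ) • z) := by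
      refine intervalIntegral.integral_eq_sub_of_hasDerivAt (f := fun s : ℝ ↦ j (a + s • z))
        (fun s hs ↦ ?_) ((continuous_comp_projIcc _).intervalIntegrable _ _)
      rw [Set.uIcc_of_le t.2.1] at hs
      have hs' : s ∈ I := ⟨hs.1, hs.2.trans t.2.2⟩
      rw [Set.projIcc_of_mem _ hs']
      simp only [pointwiseApply_apply, raySeries_sum_apply hf (mem_eball_of_le hr hzρ),
        powSmul_apply, pow_zero, one_smul]
      exact hd ⟨s, hs'⟩
    have h2 : rayOperator p z y t = j (a + (t : ℝ) • z) - j (a + (0 : ℝ) • z) := key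
    change y t - rayOperator p z y t = (t : ℝ) ^ 0 • j a
    rw [h2]
    simp [y]
  obtain ⟨u, hu⟩ := isUnit_one_sub_of_norm_lt_one (norm_rayOperator_lt_one hf hr hA hC hzρ)
  have h1 : y 1 = raySolution p (j a) z := by
    rw [raySolution, ← hy, ← hu, Ring.inverse_unit]
    have : (↑u⁻¹ * ↑u : C(I, W) →L[ℝ] C(I, W)) y = y := by simp
    exact congrArg (fun y : C(I, W) ↦ y 1) this.symm
  simpa [y] using h1

theorem SolvesOn.exists_extension (hf : HasFPowerSeriesOnBall A p a r)
    (hr : ENNReal.ofReal ρ ≤ r) (hA : ∀ z ∈ Metric.ball a ρ, ‖A z‖ ≤ C) (hC : C * ρ < 1)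
    {j : E → W} {ρ' : ℝ} (hρ' : 0 < ρ') (hj : SolvesOn A j (Metric.ball a ρ')) (hρ : ρ' ≤ ρ) :
    ∃ j' : E → W, SolvesOn A j' (Metric.ball a ρ) ∧ ContDiffOn ℝ ω j' (Metric.ball a ρ) ∧
      j' a = j a := by
  have hmem : ∀ {z : E} {R : ℝ}, z ∈ Metric.ball a R → z - a ∈ Metric.ball (0 : E) R := by
    intro z R hz; rwa [mem_ball_zero_iff, ← mem_ball_iff_norm]
  set j' : E → W := fun z ↦ raySolution p (j a) (z - a) with hj'
  have heq : ∀ z ∈ Metric.ball a ρ', j' z = j z := fun z hz ↦ by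
    have := hj.eq_raySolution hf hr hA hC hρ (hmem hz)
    rw [add_sub_cancel] at this
    exact this.symm
  have hsm : ContDiffOn ℝ ω j' (Metric.ball a ρ) := fun z hz ↦
    ((contDiffAt_raySolution hf hr hA hC (hmem hz) (j a)).comp z
      (contDiffAt_id.sub contDiffAt_const)).contDiffWithinAt
  refine ⟨j', ?_, hsm, heq a (Metric.mem_ball_self hρ')⟩
  have hAω : ContDiffOn ℝ ω A (Metric.ball a ρ) := fun z hz ↦ by
    refine (hf.analyticAt_of_mem ?_).contDiffAt.contDiffWithinAt
    rw [← Metric.eball_ofReal] at hz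
    exact Metric.eball_subset_eball hr hz
  -- the defect of the total differential equation is analytic and vanishes near `a`
  set D : E → E →L[ℝ] W := fun z ↦ fderiv ℝ j' z - (A z).flip (j' z) with hD
  have hDω : ContDiffOn ℝ ω D (Metric.ball a ρ) := by
    refine (hsm.fderiv_of_isOpen Metric.isOpen_ball (by simp)).sub (ContDiffOn.clm_apply ?_ hsm)
    exact (ContinuousLinearMap.flipₗᵢ ℝ E W W).contDiff.comp_contDiffOn hAω
  have hDan : AnalyticOnNhd ℝ D (Metric.ball a ρ) := fun z hz ↦
    (hDω.contDiffAt (Metric.isOpen_ball.mem_nhds hz)).analyticAt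
  have hD0 : D =ᶠ[𝓝 a] 0 := by
    filter_upwards [Metric.isOpen_ball.mem_nhds (Metric.mem_ball_self hρ')] with z hz
    have : j' =ᶠ[𝓝 z] j := by
      filter_upwards [Metric.isOpen_ball.mem_nhds hz] with y hy using heq y hy
    rw [hD]
    simp only [this.fderiv_eq, (hj z hz).fderiv, heq z hz, sub_self, Pi.zero_apply]
  have hzero := hDan.eqOn_zero_of_preconnected_of_eventuallyEq_zero
    (convex_ball a ρ).isPreconnected (Metric.mem_ball_self (hρ'.trans_le hρ)) hD0
  intro z hz
  have h1 := ((hsm.contDiffAt (Metric.isOpen_ball.mem_nhds hz)).differentiableAt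
    (by simp)).hasFDerivAt
  have h2 : fderiv ℝ j' z = (A z).flip (j' z) := sub_eq_zero.1 (hzero hz)
  rwa [h2] at h1

/-- Every point has a ball of uniform size to which all germs of solutions at points of the ball
extend. The extension is the solution along rays. It is analytic and solves the total differential
equation near the centre of the ray, so that it solves it everywhere by the identity theorem. Here
the analyticity of `A` is essential. -/
theorem exists_ball_forall_extension {q : E} (hA : ContDiffAt ℝ ω A q) :
    ∃ ρ > 0, ∀ a ∈ Metric.ball q ρ, ∀ ρ' > 0,
      (∀ j, SolvesOn A j (Metric.ball a ρ') → ∃ j' : E → W, SolvesOn A j' (Metric.ball q ρ) ∧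
        ContDiffOn ℝ ω j' (Metric.ball q ρ) ∧ j' a = j a) ∧
      ∀ j₁ j₂, ρ' ≤ ρ → SolvesOn A j₁ (Metric.ball a ρ') → SolvesOn A j₂ (Metric.ball a ρ') →
        j₁ a = j₂ a → Set.EqOn j₁ j₂ (Metric.ball a ρ') := by
  obtain ⟨p, r, hp⟩ := hA.analyticAt
  obtain ⟨C, hC⟩ : ∃ C : ℝ, ∀ᶠ z in 𝓝 q, ‖A z‖ < C :=
    ⟨‖A q‖ + 1, hA.continuousAt.norm.eventually_lt_const (lt_add_one _)⟩
  obtain ⟨R, hR, hRC⟩ := Metric.eventually_nhds_iff_ball.1 hC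
  have hC0 : 0 < C := (norm_nonneg _).trans_lt (hRC q (Metric.mem_ball_self hR))
  obtain ⟨r', hr'0, hr'⟩ : ∃ r' : ℝ, 0 < r' ∧ ENNReal.ofReal r' ≤ r := by
    rcases eq_or_ne r ⊤ with h | h
    · exact ⟨1, one_pos, by simp [h]⟩
    · exact ⟨r.toReal, ENNReal.toReal_pos hp.r_pos.ne' h, by rw [ENNReal.ofReal_toReal h]⟩
  -- the balls of radius `2 * ρ` around points `a` at distance less than `ρ` from `q` contain the
  -- ball of radius `ρ` around `q`, and `C * (2 * ρ) < 1` makes the ray operators contracting there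
  set ρ := min (min (R / 3) (r' / 3)) (1 / (3 * C)) with hρ
  have hρ0 : 0 < ρ := by positivity
  have hρR : ρ ≤ R / 3 := (min_le_left _ _).trans (min_le_left _ _)
  have hρr : ρ ≤ r' / 3 := (min_le_left _ _).trans (min_le_right _ _)
  have hρC : C * (2 * ρ) < 1 := by
    have : ρ ≤ 1 / (3 * C) := min_le_right _ _
    rw [le_div_iff₀ (by positivity)] at this
    nlinarith
  refine ⟨ρ, hρ0, fun a ha ρ' hρ' ↦ ?_⟩
  have haq : ‖a - q‖ < ρ := by rwa [mem_ball_iff_norm] at ha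
  have hpa : HasFPowerSeriesOnBall A (p.changeOrigin (a - q)) a (r - ‖a - q‖₊) := by
    have := hp.changeOrigin (y := a - q) (lt_of_lt_of_le ?_ hr')
    · rwa [add_sub_cancel] at this
    · rw [← enorm_eq_nnnorm, ← ofReal_norm]
      exact (ENNReal.ofReal_lt_ofReal_iff hr'0).2 (by linarith)
  have hra : ENNReal.ofReal (2 * ρ) ≤ r - ‖a - q‖₊ := by
    refine le_trans ?_ (tsub_le_tsub_right hr' _)
    rw [← enorm_eq_nnnorm, ← ofReal_norm, ← ENNReal.ofReal_sub _ (norm_nonneg _)]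
    exact ENNReal.ofReal_le_ofReal (by linarith)
  have hAa : ∀ z ∈ Metric.ball a (2 * ρ), ‖A z‖ ≤ C := fun z hz ↦ by
    refine (hRC z ?_).le
    rw [mem_ball_iff_norm] at hz ⊢
    have := norm_sub_le_norm_sub_add_norm_sub z a q
    linarith
  refine ⟨fun j hj ↦ ?_, fun j₁ j₂ hle hj₁ hj₂ h z hz ↦ ?_⟩
  · have hj' : SolvesOn A j (Metric.ball a (min ρ' (2 * ρ))) := fun z hz ↦
      hj z (Metric.ball_subset_ball (min_le_left _ _) hz)
    obtain ⟨j', h1, h2, h3⟩ := hj'.exists_extension hpa hra hAa hρC (by positivity)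
      (min_le_right _ _)
    have hsub : Metric.ball q ρ ⊆ Metric.ball a (2 * ρ) := by
      refine Metric.ball_subset_ball' ?_
      rw [dist_comm, dist_eq_norm]; linarith
    exact ⟨j', fun z hz ↦ h1 z (hsub hz), h2.mono hsub, h3⟩
  · have hz' : z - a ∈ Metric.ball (0 : E) ρ' := by
      rwa [mem_ball_zero_iff, ← mem_ball_iff_norm]
    have e1 := hj₁.eq_raySolution hpa hra hAa hρC (by linarith) hz'
    have e2 := hj₂.eq_raySolution hpa hra hAa hρC (by linarith) hz'
    rw [add_sub_cancel] at e1 e2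
    rw [e1, e2, h]

end Ode

end AnalyticTransport

/-! ### Parallel endomorphism fields in a chart -/

section ParallelEndomorphisms

variable {E : Type*} [NormedAddCommGroup E] [NormedSpace ℝ E]
  {H : Type*} [TopologicalSpace H] (I : ModelWithCorners ℝ E H)
  {M : Type*} [TopologicalSpace M] [ChartedSpace H M] [IsManifold I ω M]

/-- The field of endomorphisms `J` in the chart at `q`, as a function of the coordinates `z`. -/
def endCoord (q : M) (J : Π x : M, TangentSpace I x →L[ℝ] TangentSpace I x) (z : E) : E →L[ℝ] E :=
  toCoord I q ((extChartAt I q).symm z) ∘L J ((extChartAt I q).symm z) ∘L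
    ofCoord I q ((extChartAt I q).symm z)

variable {I}

theorem endCoord_extChartAt {q x : M} (hx : x ∈ (chartAt H q).source)
    (J : Π x : M, TangentSpace I x →L[ℝ] TangentSpace I x) :
    endCoord I q J (extChartAt I q x) = toCoord I q x ∘L J x ∘L ofCoord I q x := by
  rw [endCoord, (extChartAt I q).left_inv (by rwa [extChartAt_source])]

theorem toCoord_end {q x : M} (hx : x ∈ (chartAt H q).source)
    (J : Π x : M, TangentSpace I x →L[ℝ] TangentSpace I x) (v : TangentSpace I x) :
    toCoord I q x (J x v) = endCoord I q J (extChartAt I q x) (toCoord I q x v) := by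
  rw [endCoord_extChartAt hx]
  change _ = toCoord I q x (J x (ofCoord I q x (toCoord I q x v)))
  rw [ofCoord_toCoord hx]

theorem contMDiffAt_end_iff [I.Boundaryless] {k : ℕ∞ω} {q x : M} (hx : x ∈ (chartAt H q).source)
    (J : Π x : M, TangentSpace I x →L[ℝ] TangentSpace I x) :
    ContMDiffAt I (I.prod 𝓘(ℝ, E →L[ℝ] E)) k
      (fun x ↦ (⟨x, J x⟩ : TotalSpace (E →L[ℝ] E)
        (fun x : M ↦ TangentSpace I x →L[ℝ] TangentSpace I x))) x ↔
      ContDiffAt ℝ k (endCoord I q J) (extChartAt I q x) := by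
  have : ContMDiffVectorBundle k E (TangentSpace I : M → Type _) I :=
    ContMDiffVectorBundle.of_le (n := ω) le_top
  have hx' : x ∈ (trivializationAt (E →L[ℝ] E)
      (fun x : M ↦ TangentSpace I x →L[ℝ] TangentSpace I x) q).baseSet := by
    rw [hom_trivializationAt_baseSet]
    exact ⟨hx, hx⟩
  refine ((trivializationAt (E →L[ℝ] E)
    (fun x : M ↦ TangentSpace I x →L[ℝ] TangentSpace I x) q).contMDiffAt_section_iff hx').trans ?_
  exact contMDiffAt_iff_contDiffAt_comp_symm
    (f := fun y ↦ toCoord I q y ∘L J y ∘L ofCoord I q y) hx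

variable [FiniteDimensional ℝ E] [RiemannianBundle (fun x : M ↦ TangentSpace I x)]
  [IsContMDiffRiemannianBundle I ω E (fun x : M ↦ TangentSpace I x)]

variable (I) in
/-- The field of endomorphisms `J` is smooth and satisfies `∇ J = 0` at the point `x`. -/
structure IsParallelEndAt (J : Π x : M, TangentSpace I x →L[ℝ] TangentSpace I x) (x : M) :
    Prop where
  smooth : ContMDiffAt I (I.prod 𝓘(ℝ, E →L[ℝ] E)) ∞
    (fun x ↦ (⟨x, J x⟩ : TotalSpace (E →L[ℝ] E)
      (fun x : M ↦ TangentSpace I x →L[ℝ] TangentSpace I x))) x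
  parallel : ∀ Y : Π x : M, TangentSpace I x,
    ContMDiffAt I I.tangent ∞ (fun y ↦ (⟨y, Y y⟩ : TangentBundle I M)) x →
    ∀ v : TangentSpace I x,
      leviCivita I M (fun y ↦ J y (Y y)) x v = J x (leviCivita I M Y x v)

variable (I) in
/-- The connection form in the chart at `q` of the bundle of endomorphisms, with the sign for which
parallel endomorphisms satisfy `D_v j = endConnection I q z v j`. -/
def endConnection (q : M) (z : E) : E →L[ℝ] (E →L[ℝ] E) →L[ℝ] (E →L[ℝ] E) :=
  (ContinuousLinearMap.compL ℝ E E E).flip ∘L christoffel I q z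
    - ContinuousLinearMap.compL ℝ E E E ∘L christoffel I q z

omit [FiniteDimensional ℝ E]
  [IsContMDiffRiemannianBundle I ω E (fun x : M ↦ TangentSpace I x)] in
theorem endConnection_apply (q : M) (z v w : E) (j : E →L[ℝ] E) :
    endConnection I q z v j w = j (christoffel I q z v w) - christoffel I q z v (j w) := rfl

theorem contDiffOn_endConnection [I.Boundaryless] (q : M) :
    ContDiffOn ℝ ω (endConnection I q) (extChartAt I q).target :=
  (contDiffOn_const.clm_comp (contDiffOn_christoffel q)).sub
    (contDiffOn_const.clm_comp (contDiffOn_christoffel q))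

/-- The coordinate expression of `(∇ J) Y = ∇ (J Y) - J (∇ Y)`. -/
theorem leviCivita_end [I.Boundaryless] {q x : M} (hx : x ∈ (chartAt H q).source)
    {J : Π x : M, TangentSpace I x →L[ℝ] TangentSpace I x}
    (hJ : DifferentiableAt ℝ (endCoord I q J) (extChartAt I q x))
    {Y : Π x : M, TangentSpace I x} (hY : MDiffAt (T% Y) x) (v : TangentSpace I x) :
    toCoord I q x (leviCivita I M (fun y ↦ J y (Y y)) x v - J x (leviCivita I M Y x v)) =
      (fderiv ℝ (endCoord I q J) (extChartAt I q x) (toCoord I q x v)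
        - endConnection I q (extChartAt I q x) (toCoord I q x v)
          (endCoord I q J (extChartAt I q x))) (toCoord I q x (Y x)) := by
  have hYm := (mdifferentiableAt_section_iff hx).1 hY
  have hy := differentiableAt_comp_symm hx hYm
  have hxs : x ∈ (extChartAt I q).source := by rwa [extChartAt_source]
  have hJY : MDiffAt (T% (fun y ↦ J y (Y y))) x := by
    refine (mdifferentiableAt_section_iff hx).2 (((hJ.mdifferentiableAt.comp x
      (mdifferentiableAt_extChartAt hx)).clm_apply hYm).congr_of_eventuallyEq ?_)
    filter_upwards [eventually_chart_source hx] with y hy using toCoord_end hy J _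
  have hd : mvfderiv I (fun y ↦ toCoord I q y (J y (Y y))) x v =
      fderiv ℝ (endCoord I q J) (extChartAt I q x) (toCoord I q x v) (toCoord I q x (Y x)) +
      endCoord I q J (extChartAt I q x) (mvfderiv I (fun y ↦ toCoord I q y (Y y)) x v) := by
    rw [mvfderiv_eq_fderiv hx ((mdifferentiableAt_section_iff hx).1 hJY),
      mvfderiv_eq_fderiv hx hYm]
    have e : (fun y ↦ toCoord I q y (J y (Y y))) ∘ (extChartAt I q).symm
        =ᶠ[𝓝 (extChartAt I q x)] fun z ↦ endCoord I q J z
          (((fun y ↦ toCoord I q y (Y y)) ∘ (extChartAt I q).symm) z) := by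
      filter_upwards [(isOpen_extChartAt_target q).mem_nhds ((extChartAt I q).map_source hxs)]
        with z hz
      have hz' : (extChartAt I q).symm z ∈ (chartAt H q).source := by
        simpa using (extChartAt I q).map_target hz
      change toCoord I q _ (J _ (Y _)) = _
      rw [toCoord_end hz', (extChartAt I q).right_inv hz]
      rfl
    rw [e.fderiv_eq, fderiv_clm_apply hJ hy]
    have e0 : toCoord I q ((extChartAt I q).symm (extChartAt I q x))
        (Y ((extChartAt I q).symm (extChartAt I q x))) = toCoord I q x (Y x) := by
      rw [(extChartAt I q).left_inv hxs]
    simp only [add_apply, ContinuousLinearMap.comp_apply, ContinuousLinearMap.flip_apply,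
      Function.comp_apply, e0]
    rw [add_comm]
  rw [map_sub, leviCivita_eq hx hJY, toCoord_end hx J (leviCivita I M Y x v), leviCivita_eq hx hY,
    hd, toCoord_end hx J (Y x), map_add, sub_apply, endConnection_apply]
  abel

/-- `J` is parallel if and only if its coordinate expression solves the total differential equation
given by `endConnection`. -/
theorem isParallelEndAt_iff [I.Boundaryless] {q x : M} (hx : x ∈ (chartAt H q).source)
    {J : Π x : M, TangentSpace I x →L[ℝ] TangentSpace I x} :
    IsParallelEndAt I J x ↔ ContDiffAt ℝ ∞ (endCoord I q J) (extChartAt I q x) ∧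
      HasFDerivAt (endCoord I q J) ((endConnection I q (extChartAt I q x)).flip
        (endCoord I q J (extChartAt I q x))) (extChartAt I q x) := by
  constructor
  · intro h
    have hs := (contMDiffAt_end_iff hx J).1 h.smooth
    have hd := hs.differentiableAt (by simp)
    refine ⟨hs, ?_⟩
    convert! hd.hasFDerivAt using 1
    ext v w
    have hY := contMDiffAt_ofCoord (I := I) (k := ∞) hx (contMDiffAt_const (c := w))
    have h1 := leviCivita_end hx hd (mdifferentiableAt_ofCoord_const (I := I) hx w)
      (ofCoord I q x v)
    rw [h.parallel _ hY, sub_self, map_zero, toCoord_ofCoord hx, toCoord_ofCoord hx] at h1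
    exact (sub_eq_zero.1 h1.symm).symm
  · rintro ⟨hs, hd⟩
    refine ⟨(contMDiffAt_end_iff hx J).2 hs, fun Y hY v ↦ ?_⟩
    have h1 := leviCivita_end hx hd.differentiableAt (hY.mdifferentiableAt (by simp)) v
    rw [hd.fderiv] at h1
    rw [← sub_eq_zero, ← ofCoord_toCoord hx (leviCivita I M _ x v - _), h1]
    simp

end ParallelEndomorphisms

/-! ### Monodromy of locally constant sheaves -/

section Monodromy

variable {M : Type*} [TopologicalSpace M] {W : M → Type*}

/-- A property `Q s x` of the germ at `x` of a section `s` of the family `W` that defines a locally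
constant sheaf: a section with the property on a connected open set is determined by its value at
one point, and every point has a connected neighbourhood `B` to which all germs at points of `B`
extend. -/
structure IsLocallyConstantSheaf (Q : (Π x, W x) → M → Prop) : Prop where
  congr : ∀ {s t : Π x, W x} {x : M}, (∀ᶠ y in 𝓝 x, s y = t y) → Q s x → Q t x
  unique : ∀ {V : Set M}, IsOpen V → IsPreconnected V → ∀ {s t : Π x, W x},
    (∀ x ∈ V, Q s x) → (∀ x ∈ V, Q t x) → ∀ x ∈ V, s x = t x → ∀ y ∈ V, s y = t y
  extend : ∀ q : M, ∃ B : Set M, IsOpen B ∧ IsPreconnected B ∧ q ∈ B ∧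
    ∀ x ∈ B, ∀ s : Π x, W x, (∀ᶠ y in 𝓝 x, Q s y) → ∃ t : Π x, W x, (∀ y ∈ B, Q t y) ∧ t x = s x

/-- The étalé space of the sheaf of sections with the property `Q`. A germ at `x` is encoded by its
value in `W x`, which determines it if `Q` defines a locally constant sheaf. -/
def Etale (Q : (Π x, W x) → M → Prop) : Type _ :=
  {a : Σ x, W x // ∃ s : Π x, W x, (∀ᶠ y in 𝓝 a.1, Q s y) ∧ s a.1 = a.2}

namespace Etale

variable {Q : (Π x, W x) → M → Prop}

/-- The projection of the étalé space to the base. -/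
def proj (a : Etale Q) : M := a.1.1

/-- The section of the étalé space over an open set `V` given by a section of `W`. -/
def ofSection {V : Set M} (hV : IsOpen V) {s : Π x, W x} (hs : ∀ x ∈ V, Q s x) (x : V) : Etale Q :=
  ⟨⟨x, s x⟩, s, Filter.mem_of_superset (hV.mem_nhds x.2) hs, rfl⟩

/-- The étalé space carries the finest topology for which all sections are continuous. -/
instance : TopologicalSpace (Etale Q) :=
  ⨆ i : {p : Set M × Π x, W x // IsOpen p.1 ∧ ∀ x ∈ p.1, Q p.2 x},
    TopologicalSpace.coinduced (ofSection i.2.1 i.2.2) inferInstance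

theorem continuous_ofSection {V : Set M} (hV : IsOpen V) {s : Π x, W x} (hs : ∀ x ∈ V, Q s x) :
    Continuous (ofSection hV hs) :=
  continuous_iff_coinduced_le.2
    (le_iSup (fun i : {p : Set M × Π x, W x // IsOpen p.1 ∧ ∀ x ∈ p.1, Q p.2 x} ↦
      TopologicalSpace.coinduced (ofSection i.2.1 i.2.2) inferInstance) ⟨(V, s), hV, hs⟩)

theorem isOpen_iff {O : Set (Etale Q)} : IsOpen O ↔ ∀ (V : Set M) (hV : IsOpen V) (s : Π x, W x)
    (hs : ∀ x ∈ V, Q s x), IsOpen (ofSection hV hs ⁻¹' O) := by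
  refine ⟨fun h V hV s hs ↦ h.preimage (continuous_ofSection hV hs), fun h ↦ ?_⟩
  refine isOpen_iSup_iff.2 fun i ↦ isOpen_coinduced.2 (h _ i.2.1 _ i.2.2)

theorem continuous_proj : Continuous (proj : Etale Q → M) :=
  continuous_iSup_dom.2 fun _ ↦ continuous_coinduced_dom.2 continuous_subtype_val

theorem isOpenMap_ofSection [LocallyConnectedSpace M] (hQ : IsLocallyConstantSheaf Q) {V : Set M}
    (hV : IsOpen V) {s : Π x, W x} (hs : ∀ x ∈ V, Q s x) : IsOpenMap (ofSection hV hs) := by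
  intro O hO
  refine isOpen_iff.2 fun V' hV' s' hs' ↦ isOpen_iff_mem_nhds.2 ?_
  rintro ⟨x, hx'⟩ ⟨⟨y, hy⟩, hyO, h⟩
  obtain ⟨rfl, h⟩ := Sigma.mk.inj (congrArg Subtype.val h)
  have h := eq_of_heq h
  obtain ⟨O', hO', rfl⟩ := isOpen_induced_iff.1 hO
  obtain ⟨C, hC, hCo, hyC, hCc⟩ := locallyConnectedSpace_iff_subsets_isOpen_isConnected.1 ‹_› y
    (V ∩ V' ∩ O') (((hV.inter hV').inter hO').mem_nhds ⟨⟨hy, hx'⟩, hyO⟩)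
  have huniq := hQ.unique hCo hCc.isPreconnected (fun x hx ↦ hs x (hC hx).1.1)
    (fun x hx ↦ hs' x (hC hx).1.2) y hyC h
  filter_upwards [(hCo.preimage continuous_subtype_val).mem_nhds (x := ⟨y, hx'⟩) hyC]
  rintro ⟨z, hz'⟩ hz
  exact ⟨⟨z, (hC hz).1.1⟩, (hC hz).2, Subtype.ext (Sigma.ext rfl (heq_of_eq (huniq z hz)))⟩

theorem isCoveringMap [LocallyConnectedSpace M] (hQ : IsLocallyConstantSheaf Q) :
    IsCoveringMap (proj : Etale Q → M) := by
  intro q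
  obtain ⟨B, hBo, hBc, hqB, hB⟩ := hQ.extend q
  -- the fibre over `B` consists of the values at `q` of the sections over `B`
  let F : Type _ := {w : W q // ∃ t : Π x, W x, (∀ y ∈ B, Q t y) ∧ t q = w}
  let _ : TopologicalSpace F := ⊥
  have : DiscreteTopology F := ⟨rfl⟩
  choose t ht htq using fun w : F ↦ w.2
  let G : B × F → (proj : Etale Q → M) ⁻¹' B := fun a ↦ ⟨ofSection hBo (ht a.2) a.1, a.1.2⟩
  have hGi : Function.Injective G := by
    rintro ⟨⟨x, hx⟩, w⟩ ⟨⟨y, hy⟩, w'⟩ h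
    obtain ⟨h1, h⟩ := Sigma.mk.inj (congrArg Subtype.val (congrArg Subtype.val h))
    obtain rfl : x = y := h1
    have h := hQ.unique hBo hBc (ht w) (ht w') x hx (eq_of_heq h) q hqB
    rw [htq, htq] at h
    rw [Subtype.ext h]
  have hGs : Function.Surjective G := by
    rintro ⟨⟨⟨x, w⟩, s, hs, hsx⟩, hx⟩
    obtain ⟨t', ht', htx⟩ := hB x hx s hs
    let w' : F := ⟨t' q, t', ht', rfl⟩
    refine ⟨⟨⟨x, hx⟩, w'⟩, Subtype.ext (Subtype.ext (Sigma.ext rfl (heq_of_eq ?_)))⟩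
    exact (hQ.unique hBo hBc (ht w') ht' q hqB (htq w') x hx).trans (htx.trans hsx)
  have hGc : Continuous G := by
    refine Continuous.subtype_mk (continuous_prod_of_discrete_right.2 fun w ↦ ?_) _
    exact continuous_ofSection hBo (ht w)
  have hGo : IsOpenMap G := by
    intro O hO
    have e : G '' O = Subtype.val ⁻¹' ⋃ w : F, ofSection hBo (ht w) '' {x | (x, w) ∈ O} := by
      ext ⟨a, ha⟩
      simp only [Set.mem_image, Set.mem_preimage, Set.mem_iUnion]
      constructor
      · rintro ⟨⟨x, w⟩, hx, h⟩
        exact ⟨w, x, hx, congrArg Subtype.val h⟩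
      · rintro ⟨w, x, hx, h⟩
        exact ⟨⟨x, w⟩, hx, Subtype.ext h⟩
    rw [e]
    exact (isOpen_iUnion fun w ↦ isOpenMap_ofSection hQ hBo (ht w) _
      (hO.preimage (Continuous.prodMk_left w))).preimage continuous_subtype_val
  let H := (Equiv.ofBijective G ⟨hGi, hGs⟩).toHomeomorphOfContinuousOpen hGc hGo
  refine IsEvenlyCovered.to_isEvenlyCovered_preimage (I := F)
    ⟨inferInstance, B, hqB, hBo, hBo.preimage continuous_proj, H.symm, fun a ↦ ?_⟩
  obtain ⟨b, rfl⟩ := H.surjective a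
  rw [H.symm_apply_apply]
  rfl

end Etale

variable {Q : (Π x, W x) → M → Prop}

/-- Monodromy principle: a section with the property `Q` over an open connected set `U` such that
`π₁(U) → π₁(M)` is surjective extends to all of `M`. The section over `U` shows that the covering
map from the étalé space is surjective on fundamental groups, so that it has a section. -/
theorem IsLocallyConstantSheaf.exists_extension [ConnectedSpace M] [LocallyPathConnectedSpace M]
    (hQ : IsLocallyConstantSheaf Q) {U : Set M} (hU : IsOpen U) (hUc : IsPreconnected U) {p : M}
    (hp : p ∈ U) (hsurj : Function.Surjective
      (FundamentalGroup.map (⟨Subtype.val, continuous_subtype_val⟩ : C(U, M)) ⟨p, hp⟩))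
    {s : Π x, W x} (hs : ∀ x ∈ U, Q s x) :
    ∃ t : Π x, W x, (∀ x, Q t x) ∧ ∀ x ∈ U, t x = s x := by
  have : PathConnectedSpace M := pathConnectedSpace_iff_connectedSpace.2 inferInstance
  have cov := Etale.isCoveringMap hQ
  obtain ⟨F, ⟨hFp, hF⟩, -⟩ := cov.existsUnique_continuousMap_lifts_of_range_le
    (f := ContinuousMap.id M) (a₀ := p) (e₀ := Etale.ofSection hU hs ⟨p, hp⟩) rfl (by
      rintro g -
      obtain ⟨⟨γ⟩, rfl⟩ := hsurj g
      refine ⟨.fromPath (.mk (γ.map (Etale.continuous_ofSection hU hs))), ?_⟩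
      exact (FundamentalGroup.mapOfEq_apply _ _ _).trans rfl)
  have hF' : ∀ x, (F x).1.1 = x := fun x ↦ congrFun hF x
  choose t htF using fun x ↦ (⟨hF' x ▸ (F x).1.2, by
    rw [Sigma.ext_iff]; exact ⟨hF' x, (eqRec_heq _ _).symm⟩⟩ : ∃ w : W x, (F x).1 = ⟨x, w⟩)
  have ht : ∀ x, Q t x := by
    intro x
    obtain ⟨s', hs', hsx⟩ := (F x).2
    rw [htF x] at hs' hsx
    obtain ⟨V, hV, hVo, hxV⟩ := mem_nhds_iff.1 hs'
    refine hQ.congr ?_ (hV hxV)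
    have hO := Etale.isOpenMap_ofSection hQ hVo (s := s') hV _ isOpen_univ
    have hx : Etale.ofSection (Q := Q) hVo hV ⟨x, hxV⟩ = F x :=
      Subtype.ext ((congrArg (Sigma.mk x) hsx).trans (htF x).symm)
    filter_upwards [F.continuous.continuousAt.preimage_mem_nhds (hO.mem_nhds
      ⟨⟨x, hxV⟩, trivial, hx⟩)]
    rintro y ⟨⟨z, hz⟩, -, h⟩
    obtain ⟨rfl, h⟩ := Sigma.mk.inj ((congrArg Subtype.val h).trans (htF y))
    exact eq_of_heq h
  refine ⟨t, ht, hQ.unique hU hUc (fun x _ ↦ ht x) hs p hp ?_⟩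
  have h := congrArg Subtype.val hFp
  rw [htF p] at h
  exact eq_of_heq (Sigma.mk.inj h).2

end Monodromy

/-! ### The sheaf of parallel endomorphism fields -/

section ParallelSheaf

variable {E : Type*} [NormedAddCommGroup E] [NormedSpace ℝ E] [FiniteDimensional ℝ E]
  {H : Type*} [TopologicalSpace H] {I : ModelWithCorners ℝ E H} [I.Boundaryless]
  {M : Type*} [TopologicalSpace M] [ChartedSpace H M] [IsManifold I ω M]
  [RiemannianBundle (fun x : M ↦ TangentSpace I x)]
  [IsContMDiffRiemannianBundle I ω E (fun x : M ↦ TangentSpace I x)]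

omit [FiniteDimensional ℝ E] [RiemannianBundle (fun x : M ↦ TangentSpace I x)]
  [IsContMDiffRiemannianBundle I ω E (fun x : M ↦ TangentSpace I x)] [I.Boundaryless] in
theorem endCoord_injective {q x : M} (hx : x ∈ (chartAt H q).source)
    {J J' : Π x : M, TangentSpace I x →L[ℝ] TangentSpace I x}
    (h : endCoord I q J (extChartAt I q x) = endCoord I q J' (extChartAt I q x)) : J x = J' x := by
  ext v
  rw [← ofCoord_toCoord hx (J x v), ← ofCoord_toCoord hx (J' x v), toCoord_end hx, toCoord_end hx,
    h]

omit [FiniteDimensional ℝ E] [IsManifold I ω M] [RiemannianBundle (fun x : M ↦ TangentSpace I x)]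
  [IsContMDiffRiemannianBundle I ω E (fun x : M ↦ TangentSpace I x)] in
theorem eventually_symm_extChartAt {q x : M} (hx : x ∈ (chartAt H q).source) {p : M → Prop}
    (h : ∀ᶠ y in 𝓝 x, p y) : ∀ᶠ z in 𝓝 (extChartAt I q x), z ∈ (extChartAt I q).target ∧
      (extChartAt I q).symm z ∈ (chartAt H q).source ∧ p ((extChartAt I q).symm z) := by
  have hxs : x ∈ (extChartAt I q).source := by rwa [extChartAt_source]
  have ht := (isOpen_extChartAt_target q).mem_nhds ((extChartAt I q).map_source hxs)
  have hc : Filter.Tendsto (extChartAt I q).symm (𝓝 (extChartAt I q x)) (𝓝 x) := by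
    have := ((continuousOn_extChartAt_symm (I := I) q).continuousAt ht).tendsto
    rwa [(extChartAt I q).left_inv hxs] at this
  filter_upwards [ht, hc h, hc (eventually_chart_source hx)] with z h1 h2 h3 using ⟨h1, h3, h2⟩

theorem IsParallelEndAt.congr {J J' : Π x : M, TangentSpace I x →L[ℝ] TangentSpace I x} {x : M}
    (h : ∀ᶠ y in 𝓝 x, J y = J' y) (hJ : IsParallelEndAt I J x) : IsParallelEndAt I J' x := by
  have hx := mem_chart_source H x
  have e : endCoord I x J' =ᶠ[𝓝 (extChartAt I x x)] endCoord I x J := by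
    filter_upwards [eventually_symm_extChartAt (I := I) hx h] with z hz
    rw [endCoord, endCoord, hz.2.2]
  obtain ⟨h1, h2⟩ := (isParallelEndAt_iff hx).1 hJ
  refine (isParallelEndAt_iff hx).2 ⟨h1.congr_of_eventuallyEq e, ?_⟩
  rw [e.eq_of_nhds]
  exact h2.congr_of_eventuallyEq e

theorem eventually_solvesOn {J : Π x : M, TangentSpace I x →L[ℝ] TangentSpace I x} {q x : M}
    (hx : x ∈ (chartAt H q).source) (hJ : ∀ᶠ y in 𝓝 x, IsParallelEndAt I J y) :
    ∃ r > 0, Metric.ball (extChartAt I q x) r ⊆ (extChartAt I q).target ∧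
      ∀ r' ≤ r, SolvesOn (endConnection I q) (endCoord I q J)
        (Metric.ball (extChartAt I q x) r') := by
  obtain ⟨r, hr, h⟩ := Metric.eventually_nhds_iff_ball.1 (eventually_symm_extChartAt (I := I) hx hJ)
  refine ⟨r, hr, fun z hz ↦ (h z hz).1, fun r' hr' z hz ↦ ?_⟩
  obtain ⟨h1, h2, h3⟩ := h z (Metric.ball_subset_ball hr' hz)
  have := ((isParallelEndAt_iff h2).1 h3).2
  rwa [(extChartAt I q).right_inv h1] at this

theorem contDiffAt_endConnection {q x : M} (hx : x ∈ (chartAt H q).source) :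
    ContDiffAt ℝ ω (endConnection I q) (extChartAt I q x) :=
  (contDiffOn_endConnection q).contDiffAt ((isOpen_extChartAt_target q).mem_nhds
    ((extChartAt I q).map_source (by rwa [extChartAt_source])))

theorem IsParallelEndAt.eventually_eq {J J' : Π x : M, TangentSpace I x →L[ℝ] TangentSpace I x}
    {x : M} (hJ : ∀ᶠ y in 𝓝 x, IsParallelEndAt I J y) (hJ' : ∀ᶠ y in 𝓝 x, IsParallelEndAt I J' y)
    (h : J x = J' x) : ∀ᶠ y in 𝓝 x, J y = J' y := by
  have hx := mem_chart_source H x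
  obtain ⟨r, hr, -, h1⟩ := eventually_solvesOn (I := I) hx hJ
  obtain ⟨r', hr', -, h2⟩ := eventually_solvesOn (I := I) hx hJ'
  obtain ⟨ρ, hρ, H⟩ := exists_ball_forall_extension (contDiffAt_endConnection (I := I) hx)
  have h0 : 0 < min ρ (min r r') := by positivity
  have huniq := (H _ (Metric.mem_ball_self hρ) _ h0).2 _ _ (min_le_left _ _)
    (h1 _ ((min_le_right _ _).trans (min_le_left _ _)))
    (h2 _ ((min_le_right _ _).trans (min_le_right _ _)))
    (by rw [endCoord_extChartAt hx, endCoord_extChartAt hx, h])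
  filter_upwards [(continuousAt_extChartAt (I := I) x).preimage_mem_nhds
    (Metric.ball_mem_nhds _ h0), eventually_chart_source hx] with y hy hy'
  exact endCoord_injective hy' (huniq hy)

/-- Parallel fields of endomorphisms on a connected open set that agree at one point are equal: the
set where they agree is open by uniqueness for the total differential equation, and its complement
is open by continuity. -/
theorem isParallelEndAt_unique {V : Set M} (hV : IsOpen V) (hVc : IsPreconnected V)
    {J J' : Π x : M, TangentSpace I x →L[ℝ] TangentSpace I x}
    (hJ : ∀ x ∈ V, IsParallelEndAt I J x) (hJ' : ∀ x ∈ V, IsParallelEndAt I J' x) {x : M}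
    (hx : x ∈ V) (h : J x = J' x) : ∀ y ∈ V, J y = J' y := by
  have ho : ∀ P : M → Prop, (∀ y ∈ V, P y → ∀ᶠ z in 𝓝 y, P z) → IsOpen {y | y ∈ V ∧ P y} := by
    refine fun P hP ↦ isOpen_iff_mem_nhds.2 fun y hy ↦ ?_
    filter_upwards [hV.mem_nhds hy.1, hP y hy.1 hy.2] with z h1 h2 using ⟨h1, h2⟩
  by_contra! hne
  obtain ⟨y, hy, hne⟩ := hne
  obtain ⟨z, -, hz, hz'⟩ := hVc _ _
    (ho (fun y ↦ J y = J' y) fun y hy hJy ↦ IsParallelEndAt.eventually_eq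
      (Filter.mem_of_superset (hV.mem_nhds hy) hJ) (Filter.mem_of_superset (hV.mem_nhds hy) hJ')
      hJy)
    (ho (fun y ↦ J y ≠ J' y) fun y hy hJy ↦ by
      have hx := mem_chart_source H y
      have hc : ContinuousAt (fun z ↦ endCoord I y J (extChartAt I y z)) y :=
        ((isParallelEndAt_iff hx).1 (hJ y hy)).1.continuousAt.comp (continuousAt_extChartAt y)
      have hc' : ContinuousAt (fun z ↦ endCoord I y J' (extChartAt I y z)) y :=
        ((isParallelEndAt_iff hx).1 (hJ' y hy)).1.continuousAt.comp (continuousAt_extChartAt y)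
      filter_upwards [(hc.sub hc').eventually_ne
        (sub_ne_zero.2 fun h ↦ hJy (endCoord_injective hx h)),
        eventually_chart_source hx] with z hz hz' h
      exact hz (by rw [Pi.sub_apply, sub_eq_zero, endCoord_extChartAt hz',
        endCoord_extChartAt hz', h]))
    (fun z hz ↦ by by_cases h : J z = J' z <;> simp [hz, h])
    ⟨x, hx, hx, h⟩ ⟨y, hy, hy, hne⟩
  exact hz'.2 hz.2

variable (I M) in
/-- Parallel endomorphism fields form a locally constant sheaf. -/
theorem isLocallyConstant_isParallelEndAt :
    IsLocallyConstantSheaf (W := fun x : M ↦ TangentSpace I x →L[ℝ] TangentSpace I x)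
      (IsParallelEndAt I) where
  congr := IsParallelEndAt.congr
  unique hV hVc _ _ hs ht _ hx h := isParallelEndAt_unique hV hVc hs ht hx h
  extend q := by
    have hq := mem_chart_source H q
    obtain ⟨ρ, hρ, hext⟩ := exists_ball_forall_extension (contDiffAt_endConnection (I := I) hq)
    obtain ⟨r, hr, hrt⟩ := Metric.isOpen_iff.1 (isOpen_extChartAt_target (I := I) q) _
      (mem_extChartAt_target (I := I) q)
    have h0 : 0 < min ρ r := by positivity
    have hρb : Metric.ball (extChartAt I q q) (min ρ r) ⊆ Metric.ball (extChartAt I q q) ρ :=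
      Metric.ball_subset_ball (min_le_left _ _)
    have hrb : Metric.ball (extChartAt I q q) (min ρ r) ⊆ (extChartAt I q).target :=
      (Metric.ball_subset_ball (min_le_right _ _)).trans hrt
    refine ⟨(extChartAt I q).source ∩ extChartAt I q ⁻¹' Metric.ball (extChartAt I q q) (min ρ r),
      (continuousOn_extChartAt q).isOpen_inter_preimage (isOpen_extChartAt_source q)
        Metric.isOpen_ball, ?_, ⟨mem_extChartAt_source q, Metric.mem_ball_self h0⟩, ?_⟩
    · rw [← (extChartAt I q).symm_image_eq_source_inter_preimage hrb]
      exact (convex_ball _ _).isPreconnected.image _ ((continuousOn_extChartAt_symm q).mono hrb)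
    · rintro x ⟨hxs, hxb⟩ s hs
      have hx : x ∈ (chartAt H q).source := by rwa [extChartAt_source] at hxs
      obtain ⟨r', hr', -, hsol⟩ := eventually_solvesOn (I := I) hx hs
      obtain ⟨j, hj, hjs, hjx⟩ := (hext _ (hρb hxb) r' hr').1 _ (hsol r' le_rfl)
      let t : Π x : M, TangentSpace I x →L[ℝ] TangentSpace I x :=
        fun y ↦ ofCoord I q y ∘L j (extChartAt I q y) ∘L toCoord I q y
      have ht : ∀ z ∈ (extChartAt I q).target, endCoord I q t z = j z := by
        intro z hz
        have hz' : (extChartAt I q).symm z ∈ (chartAt H q).source := by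
          simpa using (extChartAt I q).map_target hz
        ext v
        change toCoord I q _ (ofCoord I q _ (j (extChartAt I q ((extChartAt I q).symm z))
          (toCoord I q _ (ofCoord I q _ v)))) = _
        rw [toCoord_ofCoord hz', toCoord_ofCoord hz', (extChartAt I q).right_inv hz]
      refine ⟨t, ?_, endCoord_injective (I := I) hx ?_⟩
      · rintro y ⟨hys, hyb⟩
        have hy : y ∈ (chartAt H q).source := by rwa [extChartAt_source] at hys
        have e : endCoord I q t =ᶠ[𝓝 (extChartAt I q y)] j :=
          Filter.mem_of_superset ((isOpen_extChartAt_target q).mem_nhds (hrb hyb)) ht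
        refine (isParallelEndAt_iff hy).2 ⟨?_, ?_⟩
        · exact (((hjs.contDiffAt (Metric.isOpen_ball.mem_nhds (hρb hyb))).of_le
            le_top).congr_of_eventuallyEq e)
        · rw [e.eq_of_nhds]
          exact (hj _ (hρb hyb)).congr_of_eventuallyEq e
      · rw [ht _ (hrb hxb), hjx]

end ParallelSheaf

/-! ### Linear ordinary differential equations -/

section LinearODE

variable {E : Type*} [NormedAddCommGroup E] [NormedSpace ℝ E]

open Set in
/-- `y` solves the linear differential equation `y' = A y` on `[a, b]`, in the sense that it is
continuous and satisfies the equation away from finitely many times. -/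
def IsODESolution (A : ℝ → E →L[ℝ] E) (a b : ℝ) (y : ℝ → E) : Prop :=
  ContinuousOn y (Icc a b) ∧
    ∃ s : Finset ℝ, ∀ t ∈ Ioo a b, t ∉ s → HasDerivAt y (A t (y t)) t

namespace IsODESolution

variable {A : ℝ → E →L[ℝ] E} {a b : ℝ} {y z : ℝ → E}

open Set Filter

/-- At the exceptional times the one-sided derivative is the limit of the nearby derivatives. -/
theorem hasDerivWithinAt_Ici (hA : ContinuousOn A (Icc a b)) (hy : IsODESolution A a b y) {t : ℝ}
    (ht : t ∈ Ico a b) : HasDerivWithinAt y (A t (y t)) (Ici t) t := by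
  obtain ⟨hc, s, hs⟩ := hy
  have hS : Ioo t b \ s ∈ 𝓝[>] t := by
    have h1 : ((s.erase t : Finset ℝ) : Set ℝ)ᶜ ∈ 𝓝 t :=
      (Finset.finite_toSet _).isClosed.isOpen_compl.mem_nhds (by simp)
    filter_upwards [Ioo_mem_nhdsGT ht.2, mem_nhdsWithin_of_mem_nhds h1] with x hx hx'
    refine ⟨hx, fun h ↦ hx' ?_⟩
    simpa [hx.1.ne'] using h
  have hd : ∀ x ∈ Ioo t b \ s, HasDerivAt y (A x (y x)) x := fun x hx ↦
    hs x ⟨ht.1.trans_lt hx.1.1, hx.1.2⟩ hx.2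
  have hsub : Ioo t b \ s ⊆ Icc a b := fun x hx ↦ ⟨ht.1.trans hx.1.1.le, hx.1.2.le⟩
  have htI : t ∈ Icc a b := ⟨ht.1, ht.2.le⟩
  refine hasDerivWithinAt_Ici_of_tendsto_deriv (s := Ioo t b \ s)
    (fun x hx ↦ (hd x hx).differentiableAt.differentiableWithinAt) ((hc t htI).mono hsub) hS ?_
  have hlim : Tendsto (fun x ↦ A x (y x)) (𝓝[>] t) (𝓝 (A t (y t))) :=
    ((hA.clm_apply hc) t htI).tendsto.mono_left
      ((nhdsWithin_le_iff.2 (mem_of_superset hS hsub)))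
  refine hlim.congr' ?_
  filter_upwards [hS] with x hx using (hd x hx).deriv.symm

theorem eqOn (hA : ContinuousOn A (Icc a b)) (hy : IsODESolution A a b y)
    (hz : IsODESolution A a b z) (h : y a = z a) : EqOn y z (Icc a b) := by
  obtain ⟨K, hK⟩ := isCompact_Icc.exists_bound_of_continuousOn hA
  refine ODE_solution_unique_of_mem_Icc_right (v := fun t x ↦ A t x) (s := fun _ ↦ univ)
    (K := K.toNNReal) (fun t ht ↦ ?_) hy.1 (fun t ht ↦ hy.hasDerivWithinAt_Ici hA ht)
    (fun _ _ ↦ trivial) hz.1 (fun t ht ↦ hz.hasDerivWithinAt_Ici hA ht) (fun _ _ ↦ trivial) h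
  refine ((A t).lipschitz.weaken ?_).lipschitzOnWith
  exact NNReal.le_toNNReal_of_coe_le (hK t ⟨ht.1, ht.2.le⟩)

theorem add (hy : IsODESolution A a b y) (hz : IsODESolution A a b z) :
    IsODESolution A a b (y + z) := by
  classical
  obtain ⟨hc, s, hs⟩ := hy
  obtain ⟨hc', s', hs'⟩ := hz
  refine ⟨hc.add hc', s ∪ s', fun t ht hts ↦ ?_⟩
  rw [Finset.mem_union, not_or] at hts
  convert (hs t ht hts.1).add (hs' t ht hts.2) using 1
  simp

theorem smul (hy : IsODESolution A a b y) (c : ℝ) : IsODESolution A a b (c • y) := by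
  obtain ⟨hc, s, hs⟩ := hy
  refine ⟨hc.const_smul c, s, fun t ht hts ↦ ?_⟩
  convert (hs t ht hts).const_smul c using 1
  simp

theorem congr (hy : IsODESolution A a b y)
    (h : EqOn z y (Icc a b)) : IsODESolution A a b z := by
  obtain ⟨h1, s, h2⟩ := hy
  refine ⟨h1.congr h, s, fun t ht hts ↦ ?_⟩
  rw [h (Ioo_subset_Icc_self ht)]
  exact (h2 t ht hts).congr_of_eventuallyEq
    (Filter.mem_of_superset (Icc_mem_nhds ht.1 ht.2) h)

end IsODESolution

open Set

/-- The length of the interval is bounded in terms of `A` in order that the Picard–Lindelöf theorem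
applies on a ball around the initial value whose radius is the norm of this value. -/
theorem exists_isODESolution [CompleteSpace E] {A : ℝ → E →L[ℝ] E} {a b K : ℝ}
    (hA : ContinuousOn A (Icc a b)) (hK : ∀ t ∈ Icc a b, ‖A t‖ ≤ K) (hK0 : 0 ≤ K)
    (hab : K * (b - a) ≤ 1 / 2) {t₀ : ℝ} (ht₀ : t₀ ∈ Icc a b) (v : E) :
    ∃ y, IsODESolution A a b y ∧ y t₀ = v := by
  -- on the ball of radius `‖v‖` around `v`, the norm of `A t x` is at most `K * (2 * ‖v‖)`
  have hpl : IsPicardLindelof (fun t x ↦ A t x) (⟨t₀, ht₀⟩ : Icc a b) v ‖v‖₊ 0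
      (2 * K.toNNReal * ‖v‖₊) K.toNNReal := by
    refine ⟨fun t ht ↦ ((A t).lipschitz.weaken ?_).lipschitzOnWith,
      fun x _ ↦ hA.clm_apply continuousOn_const, fun t ht x hx ↦ ?_, ?_⟩
    · exact NNReal.le_toNNReal_of_coe_le (hK t ht)
    · have h1 : ‖x‖ ≤ 2 * ‖v‖ := by
        have h2 : ‖x - v‖ ≤ ‖v‖ := mem_closedBall_iff_norm.1 hx
        have h3 := norm_sub_norm_le x v
        linarith
      calc ‖A t x‖ ≤ ‖A t‖ * ‖x‖ := (A t).le_opNorm x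
        _ ≤ K * (2 * ‖v‖) := by gcongr; exact hK t ht
        _ = _ := by push_cast [Real.coe_toNNReal K hK0]; ring
    · push_cast [Real.coe_toNNReal K hK0]
      have h1 : max (b - t₀) (t₀ - a) ≤ b - a := by
        rw [max_le_iff]; constructor <;> linarith [ht₀.1, ht₀.2]
      calc 2 * K * ‖v‖ * max (b - t₀) (t₀ - a) ≤ 2 * K * ‖v‖ * (b - a) := by gcongr
        _ = 2 * (K * (b - a)) * ‖v‖ := by ring
        _ ≤ 2 * (1 / 2) * ‖v‖ := by gcongr
        _ = ‖v‖ - 0 := by ring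
  obtain ⟨y, hy, hd⟩ := hpl.exists_eq_forall_mem_Icc_hasDerivWithinAt₀
  exact ⟨y, ⟨fun t ht ↦ (hd t ht).continuousWithinAt, ∅, fun t ht _ ↦
    (hd t (Ioo_subset_Icc_self ht)).hasDerivAt (Icc_mem_nhds ht.1 ht.2)⟩, hy⟩

/-- The solution operator of a linear differential equation on a short interval. -/
theorem exists_solutionOperator [FiniteDimensional ℝ E] {A : ℝ → E →L[ℝ] E} {a b K : ℝ}
    (h : a ≤ b) (hA : ContinuousOn A (Icc a b)) (hK : ∀ t ∈ Icc a b, ‖A t‖ ≤ K)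
    (hab : K * (b - a) ≤ 1 / 2) :
    ∃ S : E ≃L[ℝ] E, ∀ v w, (∃ y, IsODESolution A a b y ∧ y a = v ∧ y b = w) ↔ S v = w := by
  have : CompleteSpace E := FiniteDimensional.complete ℝ E
  have hK0 : 0 ≤ K := (norm_nonneg _).trans (hK a (left_mem_Icc.2 h))
  choose y hy hya using exists_isODESolution hA hK hK0 hab (left_mem_Icc.2 h)
  have hend : ∀ z, IsODESolution A a b z → z b = y (z a) b := fun z hz ↦
    hz.eqOn hA (hy _) (hya _).symm (right_mem_Icc.2 h)
  let S : E →ₗ[ℝ] E :=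
    { toFun := fun v ↦ y v b
      map_add' := fun v w ↦ by
        have h1 := hend _ ((hy v).add (hy w))
        rw [Pi.add_apply, Pi.add_apply, hya, hya] at h1
        exact h1.symm
      map_smul' := fun c v ↦ by
        have h1 := hend _ ((hy v).smul c)
        rw [Pi.smul_apply, Pi.smul_apply, hya] at h1
        exact h1.symm }
  have hS : Function.Surjective S := by
    intro w
    obtain ⟨z, hz, hzb⟩ := exists_isODESolution hA hK hK0 hab (right_mem_Icc.2 h) w
    exact ⟨z a, (hend z hz).symm.trans hzb⟩
  refine ⟨(LinearEquiv.ofBijective S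
    ⟨LinearMap.injective_iff_surjective.2 hS, hS⟩).toContinuousLinearEquiv, fun v w ↦ ⟨?_, ?_⟩⟩
  · rintro ⟨z, hz, rfl, rfl⟩
    exact (hend z hz).symm
  · intro h
    exact ⟨y v, hy v, hya v, h⟩

end LinearODE

/-! ### The covariant derivative along a curve in a chart -/

section AlongCurves

variable {E : Type*} [NormedAddCommGroup E] [NormedSpace ℝ E]
  {H : Type*} [TopologicalSpace H] {I : ModelWithCorners ℝ E H}
  {M : Type*} [TopologicalSpace M] [ChartedSpace H M] [IsManifold I ω M]
  {γ : ℝ → M} {V : Π t : ℝ, TangentSpace I (γ t)} {q : M} {t : ℝ}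

theorem toCoord_velocity (hq : γ t ∈ (chartAt H q).source)
    (hγ : MDifferentiableAt 𝓘(ℝ, ℝ) I γ t) :
    toCoord I q (γ t) (mfderiv 𝓘(ℝ, ℝ) I γ t (1 : ℝ)) = deriv (extChartAt I q ∘ γ) t := by
  rw [toCoord_eq_mfderiv hq, ← fderiv_apply_one_eq_deriv, ← mfderiv_eq_fderiv,
    mfderiv_comp t (mdifferentiableAt_extChartAt hq) hγ]
  rfl

theorem differentiableAt_extChartAt_comp (hq : γ t ∈ (chartAt H q).source)
    (hγ : MDifferentiableAt 𝓘(ℝ, ℝ) I γ t) : DifferentiableAt ℝ (extChartAt I q ∘ γ) t :=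
  mdifferentiableAt_iff_differentiableAt.1 ((mdifferentiableAt_extChartAt hq).comp t hγ)

theorem mdifferentiableAt_along_iff (hq : γ t ∈ (chartAt H q).source)
    (hγ : MDifferentiableAt 𝓘(ℝ, ℝ) I γ t) :
    MDifferentiableAt 𝓘(ℝ, ℝ) I.tangent (fun u : ℝ ↦ (⟨γ u, V u⟩ : TangentBundle I M)) t ↔
      DifferentiableAt ℝ (fun s ↦ toCoord I q (γ s) (V s)) t := by
  have h1 := (trivializationAt E (TangentSpace I : M → Type _) q).mdifferentiableAt_totalSpace_iff
    (IB := I) (IM := 𝓘(ℝ, ℝ)) (fun u : ℝ ↦ (⟨γ u, V u⟩ : TangentBundle I M)) (x₀ := t)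
    ((Trivialization.mem_source _).2 hq)
  refine h1.trans ((and_iff_right hγ).trans ?_)
  rw [mdifferentiableAt_iff_differentiableAt]
  refine Filter.EventuallyEq.differentiableAt_iff ?_
  filter_upwards [hγ.continuousAt.preimage_mem_nhds (eventually_chart_source hq)] with s hs
  exact (toCoord_apply hs _).symm

open Set in
theorem continuousWithinAt_along_iff {S : Set ℝ} (hq : γ t ∈ (chartAt H q).source)
    (hγ : ContinuousWithinAt γ S t) :
    ContinuousWithinAt (fun u : ℝ ↦ (⟨γ u, V u⟩ : TangentBundle I M)) S t ↔
      ContinuousWithinAt (fun s ↦ toCoord I q (γ s) (V s)) S t := by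
  let e := trivializationAt E (TangentSpace I : M → Type _) q
  have hS : ∀ᶠ s in 𝓝[S] t, γ s ∈ (chartAt H q).source :=
    hγ.preimage_mem_nhdsWithin (eventually_chart_source hq)
  have hS' : (fun u : ℝ ↦ (⟨γ u, V u⟩ : TangentBundle I M)) ⁻¹' e.source ∈ 𝓝[S] t := by
    filter_upwards [hS] with s hs using e.mem_source.2 hs
  have heq : (e ∘ fun u : ℝ ↦ (⟨γ u, V u⟩ : TangentBundle I M)) =ᶠ[𝓝[S] t]
      fun s ↦ (γ s, toCoord I q (γ s) (V s)) := by
    filter_upwards [hS] with s hs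
    exact Prod.ext (e.coe_fst (e.mem_source.2 hs)) (toCoord_apply hs _).symm
  have hq' : (⟨γ t, V t⟩ : TangentBundle I M) ∈ e.source := e.mem_source.2 hq
  refine (e.toOpenPartialHomeomorph.continuousWithinAt_iff_continuousWithinAt_comp_left
    (f := fun u : ℝ ↦ (⟨γ u, V u⟩ : TangentBundle I M)) hq' hS').trans ?_
  refine (Filter.EventuallyEq.congr_continuousWithinAt heq ?_).trans ?_
  · exact Prod.ext (e.coe_fst hq') (toCoord_apply hq _).symm
  · exact ⟨fun h ↦ h.snd, fun h ↦ hγ.prodMk h⟩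

variable [FiniteDimensional ℝ E] [I.Boundaryless]
  [RiemannianBundle (fun x : M ↦ TangentSpace I x)]
  [IsContMDiffRiemannianBundle I ω E (fun x : M ↦ TangentSpace I x)]

/-- The covariant derivative along a curve is `dV/dt + Γ(γ', V)` in every chart, not only in the
chart at `γ t` which occurs in its definition. -/
theorem toCoord_covDerivAlong (hq : γ t ∈ (chartAt H q).source)
    (hγ : MDifferentiableAt 𝓘(ℝ, ℝ) I γ t)
    (hV : DifferentiableAt ℝ (fun s ↦ toCoord I q (γ s) (V s)) t) :
    toCoord I q (γ t) (covDerivAlong I γ V t) = deriv (fun s ↦ toCoord I q (γ s) (V s)) t +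
      christoffel I q (extChartAt I q (γ t)) (deriv (extChartAt I q ∘ γ) t)
        (toCoord I q (γ t) (V t)) := by
  set x := γ t with hx
  have hxx := mem_chart_source H x
  set c : ℝ → E := fun s ↦ toCoord I x (γ s) (V s) with hc
  have hcd : DifferentiableAt ℝ c t :=
    (mdifferentiableAt_along_iff hxx hγ).1 ((mdifferentiableAt_along_iff hq hγ).2 hV)
  -- the change of frames from the chart at `x` to the chart at `q`
  let T : M → E →L[ℝ] E := fun y ↦ toCoord I q y ∘L ofCoord I x y
  have hT : MDifferentiableAt I 𝓘(ℝ, E →L[ℝ] E) T x := by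
    refine (mdifferentiableAt_coordChangeL (IB := I) (𝕜 := ℝ)
      (e := trivializationAt E (TangentSpace I : M → Type _) x)
      (e' := trivializationAt E (TangentSpace I : M → Type _) q) hxx hq).congr_of_eventuallyEq ?_
    filter_upwards [eventually_chart_source hxx, eventually_chart_source hq] with y h1 h2
    ext v
    change toCoord I q y (ofCoord I x y v) = _
    rw [toCoord_apply h2, ofCoord_apply h1]
    exact (Trivialization.coordChangeL_apply _ _ ⟨h1, h2⟩ v).symm
  have hTγ : DifferentiableAt ℝ (T ∘ γ) t :=
    mdifferentiableAt_iff_differentiableAt.1 (hT.comp t hγ)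
  have hd : deriv (fun s ↦ toCoord I q (γ s) (V s)) t =
      deriv (T ∘ γ) t (c t) + T x (deriv c t) := by
    have e : (fun s ↦ toCoord I q (γ s) (V s)) =ᶠ[𝓝 t] fun s ↦ (T ∘ γ) s (c s) := by
      filter_upwards [hγ.continuousAt.preimage_mem_nhds (eventually_chart_source hxx)] with s hs
      exact congrArg (toCoord I q (γ s)) (ofCoord_toCoord hs (V s)).symm
    rw [e.deriv_eq, (hTγ.hasDerivAt.clm_apply hcd.hasDerivAt).deriv]
    rfl
  -- the extension of `V t` has the constant coefficients `c t` in the frame at `x`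
  set σ : Π y : M, TangentSpace I y := extend E (V t) with hσ
  have hσm : MDiffAt (T% σ) x := mdifferentiableAt_extend I E (V t)
  have hσd : mvfderiv I (fun y ↦ toCoord I q y (σ y)) x (mfderiv 𝓘(ℝ, ℝ) I γ t (1 : ℝ)) =
      deriv (T ∘ γ) t (c t) := by
    have hm := (mdifferentiableAt_section_iff hq).1 hσm
    have h2 := differentiableAt_comp_symm hq hm
    rw [mvfderiv_eq_fderiv hq hm, toCoord_velocity hq hγ]
    have h3 := (h2.hasFDerivAt.comp_hasDerivAt_of_eq t
      (differentiableAt_extChartAt_comp hq hγ).hasDerivAt rfl)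
    rw [← h3.deriv]
    have e : ((fun y ↦ toCoord I q y (σ y)) ∘ (extChartAt I q).symm) ∘ extChartAt I q ∘ γ
        =ᶠ[𝓝 t] fun s ↦ (T ∘ γ) s (c t) := by
      filter_upwards [hγ.continuousAt.preimage_mem_nhds (eventually_chart_source hxx),
        hγ.continuousAt.preimage_mem_nhds (eventually_chart_source hq)] with s h1 h2
      have e0 : (extChartAt I q).symm (extChartAt I q (γ s)) = γ s :=
        (extChartAt I q).left_inv (by rwa [extChartAt_source])
      change toCoord I q ((extChartAt I q).symm (extChartAt I q (γ s)))
        (σ ((extChartAt I q).symm (extChartAt I q (γ s)))) = _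
      rw [e0]
      change toCoord I q (γ s) _ = toCoord I q (γ s) (ofCoord I x (γ s) (c t))
      rw [ofCoord_apply h1]
      simp only [hc, hσ, extend]
      rw [toCoord_apply hxx]
    rw [e.deriv_eq, (hTγ.hasDerivAt.clm_apply (hasDerivAt_const t (c t))).deriv]
    simp
  have hdef : covDerivAlong I γ V t = ofCoord I x x (deriv c t) +
      leviCivita I M σ x (mfderiv 𝓘(ℝ, ℝ) I γ t (1 : ℝ)) := by
    rw [ofCoord_apply hxx]
    have e : c =ᶠ[𝓝 t] fun s : ℝ ↦
        (trivializationAt E (TangentSpace I : M → Type _) x ⟨γ s, V s⟩).2 := by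
      filter_upwards [hγ.continuousAt.preimage_mem_nhds (eventually_chart_source hxx)] with s hs
      exact toCoord_apply hs _
    rw [e.deriv_eq]
    rfl
  rw [hdef, map_add, leviCivita_eq hq hσm, hσd, toCoord_velocity hq hγ, hd, hσ, extend_apply_self]
  change T x (deriv c t) + _ = _
  abel

end AlongCurves

/-! ### Parallel transport along piecewise smooth paths -/

section ParallelTransport

variable {E : Type*} [NormedAddCommGroup E] [NormedSpace ℝ E] [FiniteDimensional ℝ E]
  {H : Type*} [TopologicalSpace H] (I : ModelWithCorners ℝ E H)
  {M : Type*} [TopologicalSpace M] [ChartedSpace H M] [IsManifold I ω M]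
  [RiemannianBundle (fun x : M ↦ TangentSpace I x)]
  [IsContMDiffRiemannianBundle I ω E (fun x : M ↦ TangentSpace I x)]

open Set

/-- `V` is a parallel vector field along `γ` on the interval `[a, b]`, see `IsParallelAlong`. -/
def IsParallelOn (γ : ℝ → M) (a b : ℝ) (V : Π t : ℝ, TangentSpace I (γ t)) : Prop :=
  ContinuousOn (fun t : ℝ ↦ (⟨γ t, V t⟩ : TangentBundle I M)) (Icc a b) ∧
    ∃ s : Finset ℝ, ∀ t ∈ Ioo a b, t ∉ s →
      MDifferentiableAt 𝓘(ℝ, ℝ) I.tangent (fun u : ℝ ↦ (⟨γ u, V u⟩ : TangentBundle I M)) t ∧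
      covDerivAlong I γ V t = 0

/-- Parallel transport along `γ` from time `a` to time `b` exists. -/
def HasTransport (γ : ℝ → M) (a b : ℝ) : Prop :=
  ∃ T : TangentSpace I (γ a) ≃L[ℝ] TangentSpace I (γ b), ∀ v w,
    (∃ V : Π t : ℝ, TangentSpace I (γ t), IsParallelOn I γ a b V ∧ V a = v ∧ V b = w) ↔ T v = w

variable {I} {γ : ℝ → M} {a b c d : ℝ}

theorem covDerivAlong_congr {V W : Π t : ℝ, TangentSpace I (γ t)} {t : ℝ}
    (h : ∀ᶠ s in 𝓝 t, V s = W s) : covDerivAlong I γ V t = covDerivAlong I γ W t := by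
  simp only [covDerivAlong]
  congr 2
  · refine Filter.EventuallyEq.deriv_eq ?_
    filter_upwards [h] with s hs
    rw [hs]
  · rw [h.self_of_nhds]

theorem IsParallelOn.mono {V : Π t : ℝ, TangentSpace I (γ t)} (h : IsParallelOn I γ a b V)
    (hc : a ≤ c) (hd : d ≤ b) : IsParallelOn I γ c d V := by
  obtain ⟨h1, s, h2⟩ := h
  exact ⟨h1.mono (Icc_subset_Icc hc hd), s, fun t ht ↦ h2 t (Ioo_subset_Ioo hc hd ht)⟩

open Classical in
theorem IsParallelOn.glue {V W : Π t : ℝ, TangentSpace I (γ t)} (hab : a ≤ b) (hbc : b ≤ c)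
    (hV : IsParallelOn I γ a b V) (hW : IsParallelOn I γ b c W) (h : V b = W b) :
    IsParallelOn I γ a c (fun t ↦ if t ≤ b then V t else W t) := by
  obtain ⟨h1, s, h2⟩ := hV
  obtain ⟨h3, s', h4⟩ := hW
  refine ⟨?_, insert b (s ∪ s'), fun t ht hts ↦ ?_⟩
  · rw [← Icc_union_Icc_eq_Icc hab hbc]
    refine ContinuousOn.union_of_isClosed (h1.congr fun t ht ↦ ?_) (h3.congr fun t ht ↦ ?_)
      isClosed_Icc isClosed_Icc
    · simp only [if_pos ht.2]
    · rcases ht.1.eq_or_lt with rfl | hlt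
      · simp only [le_refl, if_true, h]
      · simp only [if_neg hlt.not_ge]
  · simp only [Finset.mem_insert, Finset.mem_union, not_or] at hts
    rcases lt_or_gt_of_ne hts.1 with hlt | hlt
    · have e : ∀ᶠ s in 𝓝 t, (if s ≤ b then V s else W s) = V s := by
        filter_upwards [eventually_lt_nhds hlt] with s hs using if_pos hs.le
      obtain ⟨hm, hc⟩ := h2 t ⟨ht.1, hlt⟩ hts.2.1
      refine ⟨hm.congr_of_eventuallyEq ?_, (covDerivAlong_congr e).trans hc⟩
      filter_upwards [e] with s hs
      rw [hs]
    · have e : ∀ᶠ s in 𝓝 t, (if s ≤ b then V s else W s) = W s := by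
        filter_upwards [eventually_gt_nhds hlt] with s hs using if_neg hs.not_ge
      obtain ⟨hm, hc⟩ := h4 t ⟨hlt, ht.2⟩ hts.2.2
      refine ⟨hm.congr_of_eventuallyEq ?_, (covDerivAlong_congr e).trans hc⟩
      filter_upwards [e] with s hs
      rw [hs]

theorem HasTransport.refl (γ : ℝ → M) (a : ℝ) : HasTransport I γ a a := by
  classical
  refine ⟨.refl ℝ _, fun v w ↦ ⟨?_, ?_⟩⟩
  · rintro ⟨V, -, rfl, rfl⟩
    rfl
  · rintro rfl
    exact ⟨Function.update 0 a v, ⟨by simp, ∅, by simp⟩, by simp, by simp⟩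

theorem HasTransport.trans (hab : a ≤ b) (hbc : b ≤ c) (h : HasTransport I γ a b)
    (h' : HasTransport I γ b c) : HasTransport I γ a c := by
  classical
  obtain ⟨T, hT⟩ := h
  obtain ⟨T', hT'⟩ := h'
  refine ⟨T.trans T', fun v w ↦ ⟨?_, ?_⟩⟩
  · rintro ⟨V, hV, rfl, rfl⟩
    have h1 := (hT _ _).1 ⟨V, hV.mono le_rfl hbc, rfl, rfl⟩
    have h2 := (hT' _ _).1 ⟨V, hV.mono hab le_rfl, rfl, rfl⟩
    rw [ContinuousLinearEquiv.trans_apply, h1, h2]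
  · rintro rfl
    obtain ⟨V, hV, hVa, hVb⟩ := (hT v _).2 rfl
    obtain ⟨W, hW, hWb, hWc⟩ := (hT' (T v) _).2 rfl
    refine ⟨_, hV.glue hab hbc hW (hVb.trans hWb.symm), ?_, ?_⟩
    · simp only [if_pos hab, hVa]
    · rcases hbc.eq_or_lt with rfl | hlt
      · simp only [le_refl, if_true, ContinuousLinearEquiv.trans_apply, ← hWc, hWb, hVb]
      · simp only [if_neg hlt.not_ge, hWc, ContinuousLinearEquiv.trans_apply]

variable (I) in
/-- The coordinates of tangent vectors at a point of a chart, as a linear equivalence. -/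
def coordEquiv {q x : M} (hx : x ∈ (chartAt H q).source) : TangentSpace I x ≃L[ℝ] E :=
  .equivOfInverse (toCoord I q x) (ofCoord I q x) (ofCoord_toCoord hx) (toCoord_ofCoord hx)

variable [I.Boundaryless]

variable (I) in
/-- The coefficient of the linear differential equation satisfied by the coordinates of parallel
vector fields along a curve `γ : [c, d] → M` contained in the chart at `q`. -/
def transportCoeff (γ : ℝ → M) (q : M) (c d t : ℝ) : E →L[ℝ] E :=
  -christoffel I q (extChartAt I q (γ t)) (derivWithin (extChartAt I q ∘ γ) (Icc c d) t)

theorem continuousOn_transportCoeff {q : M} (hcd : c < d)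
    (hγ : ContMDiffOn 𝓘(ℝ, ℝ) I ∞ γ (Icc c d))
    (hq : ∀ t ∈ Icc c d, γ t ∈ (chartAt H q).source) :
    ContinuousOn (transportCoeff I γ q c d) (Icc c d) := by
  have hq' : MapsTo γ (Icc c d) (chartAt H q).source := hq
  have hu : ContDiffOn ℝ ∞ (extChartAt I q ∘ γ) (Icc c d) :=
    contMDiffOn_iff_contDiffOn.1 (contMDiffOn_extChartAt.comp hγ hq')
  have hdu := hu.continuousOn_derivWithin (uniqueDiffOn_Icc hcd) (by simp)
  have hC : ContinuousOn (fun t ↦ christoffel I q (extChartAt I q (γ t))) (Icc c d) :=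
    (contDiffOn_christoffel (I := I) q).continuousOn.comp hu.continuousOn fun t ht ↦
      (extChartAt I q).map_source (by rw [extChartAt_source]; exact hq t ht)
  exact (hC.clm_apply hdu).neg

theorem isParallelOn_iff {q : M} (hγ : ContMDiffOn 𝓘(ℝ, ℝ) I ∞ γ (Icc c d))
    (hq : ∀ t ∈ Icc c d, γ t ∈ (chartAt H q).source) (ha : c ≤ a) (hb : b ≤ d)
    (V : Π t : ℝ, TangentSpace I (γ t)) :
    IsParallelOn I γ a b V ↔ IsODESolution (transportCoeff I γ q c d) a b
      (fun t ↦ toCoord I q (γ t) (V t)) := by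
  have hsub := Icc_subset_Icc ha hb
  refine and_congr (forall₂_congr fun t ht ↦ ?_) (exists_congr fun s ↦
    forall₂_congr fun t ht ↦ imp_congr_right fun _ ↦ ?_)
  · exact continuousWithinAt_along_iff (hq t (hsub ht)) ((hγ.continuousOn t (hsub ht)).mono hsub)
  · have hn : Icc c d ∈ 𝓝 t := Icc_mem_nhds (ha.trans_lt ht.1) (ht.2.trans_le hb)
    have htq := hq t (hsub (Ioo_subset_Icc_self ht))
    have hm : MDifferentiableAt 𝓘(ℝ, ℝ) I γ t := (hγ.contMDiffAt hn).mdifferentiableAt (by simp)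
    have key : ∀ hV : DifferentiableAt ℝ (fun s ↦ toCoord I q (γ s) (V s)) t,
        covDerivAlong I γ V t = 0 ↔ deriv (fun s ↦ toCoord I q (γ s) (V s)) t =
          transportCoeff I γ q c d t (toCoord I q (γ t) (V t)) := by
      intro hV
      rw [← (coordEquiv I htq).map_eq_zero_iff]
      change toCoord I q (γ t) _ = 0 ↔ _
      rw [toCoord_covDerivAlong htq hm hV, transportCoeff, derivWithin_of_mem_nhds hn,
        neg_apply, eq_neg_iff_add_eq_zero]
    rw [mdifferentiableAt_along_iff htq hm]
    constructor
    · rintro ⟨h1, h2⟩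
      rw [← (key h1).1 h2]
      exact h1.hasDerivAt
    · exact fun h ↦ ⟨h.differentiableAt, (key h.differentiableAt).2 h.deriv⟩

theorem exists_hasTransport_of_chart {q : M} (hcd : c < d)
    (hγ : ContMDiffOn 𝓘(ℝ, ℝ) I ∞ γ (Icc c d))
    (hq : ∀ t ∈ Icc c d, γ t ∈ (chartAt H q).source) :
    ∃ δ > 0, ∀ a b, c ≤ a → a ≤ b → b ≤ d → b - a ≤ δ → HasTransport I γ a b := by
  have hA := continuousOn_transportCoeff hcd hγ hq
  obtain ⟨K, hK⟩ := isCompact_Icc.exists_bound_of_continuousOn hA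
  have hK0 : 0 ≤ K := (norm_nonneg _).trans (hK c (left_mem_Icc.2 hcd.le))
  refine ⟨1 / (2 * (K + 1)), by positivity, fun a b ha hab hb hδ ↦ ?_⟩
  have hsub := Icc_subset_Icc ha hb
  have hlen : K * (b - a) ≤ 1 / 2 := by
    calc K * (b - a) ≤ K * (1 / (2 * (K + 1))) := by gcongr
      _ = K / (K + 1) * (1 / 2) := by field_simp
      _ ≤ 1 * (1 / 2) := by
        gcongr
        rw [div_le_one (by positivity)]
        linarith
      _ = 1 / 2 := one_mul _
  obtain ⟨S, hS⟩ := exists_solutionOperator hab (hA.mono hsub) (fun t ht ↦ hK t (hsub ht)) hlen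
  have hqa := hq a (hsub (left_mem_Icc.2 hab))
  have hqb := hq b (hsub (right_mem_Icc.2 hab))
  refine ⟨(coordEquiv I hqa).trans (S.trans (coordEquiv I hqb).symm), fun v w ↦ ?_⟩
  rw [ContinuousLinearEquiv.trans_apply, ContinuousLinearEquiv.trans_apply,
    ContinuousLinearEquiv.symm_apply_eq, ← hS]
  constructor
  · rintro ⟨V, hV, rfl, rfl⟩
    exact ⟨_, (isParallelOn_iff hγ hq ha hb V).1 hV, rfl, rfl⟩
  · rintro ⟨y, hy, hya, hyb⟩
    refine ⟨fun t ↦ ofCoord I q (γ t) (y t), (isParallelOn_iff hγ hq ha hb _).2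
      (hy.congr fun t ht ↦ toCoord_ofCoord (hq t (hsub ht)) _), ?_, ?_⟩
    · exact (congrArg (ofCoord I q (γ a)) hya).trans (ofCoord_toCoord hqa v)
    · exact (congrArg (ofCoord I q (γ b)) hyb).trans (ofCoord_toCoord hqb w)

/-- Transport on short intervals to the right of `t₀`: there `γ` is smooth up to the boundary point
`t₀`, even if `t₀` is a break point. -/
theorem exists_hasTransport_right (hγ : IsPiecewiseSmoothPath I γ) {t₀ : ℝ}
    (ht₀ : t₀ ∈ Icc (0 : ℝ) 1) :
    ∃ δ > 0, ∀ a b, t₀ ≤ a → a ≤ b → b ≤ 1 → b ≤ t₀ + δ → HasTransport I γ a b := by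
  rcases ht₀.2.eq_or_lt with rfl | hlt
  · refine ⟨1, one_pos, fun a b h1 h2 h3 _ ↦ ?_⟩
    obtain rfl : a = b := le_antisymm h2 (h3.trans h1)
    exact HasTransport.refl γ a
  obtain ⟨hc, s, hs⟩ := hγ
  have h1 : ((s.erase t₀ : Finset ℝ) : Set ℝ)ᶜ ∈ 𝓝 t₀ :=
    (Finset.finite_toSet _).isClosed.isOpen_compl.mem_nhds (by simp)
  have h2 : ∀ᶠ t in 𝓝[>] t₀, γ t ∈ (chartAt H (γ t₀)).source := by
    refine ((hc t₀ ht₀).mono_left (nhdsWithin_le_iff.2 ?_)).eventually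
      (eventually_chart_source (mem_chart_source H (γ t₀)))
    filter_upwards [Ioo_mem_nhdsGT hlt] with t ht using ⟨ht₀.1.trans ht.1.le, ht.2.le⟩
  obtain ⟨d, hd, hsub⟩ := mem_nhdsGT_iff_exists_Ioc_subset.1
    (Filter.inter_mem (Filter.inter_mem (Ioo_mem_nhdsGT hlt) (mem_nhdsWithin_of_mem_nhds h1)) h2)
  have hd1 : d ≤ 1 := (hsub (right_mem_Ioc.2 hd)).1.1.2.le
  obtain ⟨δ, hδ, H⟩ := exists_hasTransport_of_chart (I := I) (q := γ t₀) hd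
    (hs t₀ d ht₀.1 hd hd1 (disjoint_left.2 fun t ht hts ↦
      (hsub (Ioo_subset_Ioc_self ht)).1.2 (by simpa [ht.1.ne'] using hts)))
    (fun t ht ↦ by
      rcases ht.1.eq_or_lt with rfl | h
      · exact mem_chart_source H (γ t₀)
      · exact (hsub ⟨h, ht.2⟩).2)
  refine ⟨min δ (d - t₀), lt_min hδ (sub_pos.2 hd), fun a b h1 h2 h3 h4 ↦ H a b h1 h2 ?_ ?_⟩
  · linarith [min_le_right δ (d - t₀)]
  · linarith [min_le_left δ (d - t₀)]

theorem exists_hasTransport_left (hγ : IsPiecewiseSmoothPath I γ) {t₀ : ℝ}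
    (ht₀ : t₀ ∈ Icc (0 : ℝ) 1) :
    ∃ δ > 0, ∀ a b, 0 ≤ a → t₀ - δ ≤ a → a ≤ b → b ≤ t₀ → HasTransport I γ a b := by
  rcases ht₀.1.eq_or_lt with rfl | hlt
  · refine ⟨1, one_pos, fun a b h1 _ h2 h3 ↦ ?_⟩
    obtain rfl : a = b := le_antisymm h2 (h3.trans h1)
    exact HasTransport.refl γ a
  obtain ⟨hc, s, hs⟩ := hγ
  have h1 : ((s.erase t₀ : Finset ℝ) : Set ℝ)ᶜ ∈ 𝓝 t₀ :=
    (Finset.finite_toSet _).isClosed.isOpen_compl.mem_nhds (by simp)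
  have h2 : ∀ᶠ t in 𝓝[<] t₀, γ t ∈ (chartAt H (γ t₀)).source := by
    refine ((hc t₀ ht₀).mono_left (nhdsWithin_le_iff.2 ?_)).eventually
      (eventually_chart_source (mem_chart_source H (γ t₀)))
    filter_upwards [Ioo_mem_nhdsLT hlt] with t ht using ⟨ht.1.le, ht.2.le.trans ht₀.2⟩
  obtain ⟨d, hd, hsub⟩ := mem_nhdsLT_iff_exists_Ico_subset.1
    (Filter.inter_mem (Filter.inter_mem (Ioo_mem_nhdsLT hlt) (mem_nhdsWithin_of_mem_nhds h1)) h2)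
  have hd1 : 0 ≤ d := (hsub (left_mem_Ico.2 hd)).1.1.1.le
  obtain ⟨δ, hδ, H⟩ := exists_hasTransport_of_chart (I := I) (q := γ t₀) hd
    (hs d t₀ hd1 hd ht₀.2 (disjoint_left.2 fun t ht hts ↦
      (hsub (Ioo_subset_Ico_self ht)).1.2 (by simpa [ht.2.ne] using hts)))
    (fun t ht ↦ by
      rcases ht.2.eq_or_lt with rfl | h
      · exact mem_chart_source H (γ t)
      · exact (hsub ⟨ht.1, h⟩).2)
  refine ⟨min δ (t₀ - d), lt_min hδ (sub_pos.2 hd), fun a b h1 h2 h3 h4 ↦ H a b ?_ h3 h4 ?_⟩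
  · linarith [min_le_right δ (t₀ - d)]
  · linarith [min_le_left δ (t₀ - d)]

theorem exists_hasTransport_near (hγ : IsPiecewiseSmoothPath I γ) (t₀ : unitInterval) :
    ∃ δ > 0, ∀ a b : unitInterval, a ≤ b → a ∈ Metric.ball t₀ δ → b ∈ Metric.ball t₀ δ →
      HasTransport I γ a b := by
  obtain ⟨δ, hδ, h⟩ := exists_hasTransport_right hγ t₀.2
  obtain ⟨δ', hδ', h'⟩ := exists_hasTransport_left hγ t₀.2
  refine ⟨min δ δ', lt_min hδ hδ', fun a b hab ha hb ↦ ?_⟩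
  have hab' : (a : ℝ) ≤ b := hab
  rw [Metric.mem_ball, Subtype.dist_eq, Real.dist_eq, abs_lt] at ha hb
  have h1 := min_le_left δ δ'
  have h2 := min_le_right δ δ'
  rcases le_total (t₀ : ℝ) a with hta | hta
  · exact h a b hta hab b.2.2 (by linarith)
  rcases le_total (b : ℝ) t₀ with htb | htb
  · exact h' a b a.2.1 (by linarith) hab htb
  exact (h' a t₀ a.2.1 (by linarith) hta le_rfl).trans hta htb
    (h t₀ b le_rfl htb b.2.2 (by linarith))

/-- Parallel transport exists along piecewise smooth paths. -/
theorem hasTransport_of_isPiecewiseSmoothPath (hγ : IsPiecewiseSmoothPath I γ) :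
    HasTransport I γ 0 1 := by
  choose δ hδ H using exists_hasTransport_near (I := I) hγ
  obtain ⟨t, t0, tm, ⟨n, hn⟩, hsub⟩ := exists_monotone_Icc_subset_open_cover_unitInterval
    (c := fun t₀ : unitInterval ↦ Metric.ball t₀ (δ t₀)) (fun _ ↦ Metric.isOpen_ball)
    (fun t _ ↦ mem_iUnion.2 ⟨t, Metric.mem_ball_self (hδ t)⟩)
  have key : ∀ m, HasTransport I γ 0 (t m) := by
    intro m
    induction m with
    | zero => rw [t0]; exact HasTransport.refl γ 0
    | succ m ih =>
      obtain ⟨t₀, ht₀⟩ := hsub m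
      have hm := tm m.le_succ
      exact ih.trans (t m).2.1 hm (H t₀ _ _ hm (ht₀ (left_mem_Icc.2 hm)) (ht₀ (right_mem_Icc.2 hm)))
  have := key n
  rwa [hn n le_rfl] at this

end ParallelTransport

/-! ### Parallel complex structures -/

section ComplexStructure

variable {E : Type*} [NormedAddCommGroup E] [NormedSpace ℝ E] [FiniteDimensional ℝ E]
  {H : Type*} [TopologicalSpace H] {I : ModelWithCorners ℝ E H} [I.Boundaryless]
  {M : Type*} [TopologicalSpace M] [ChartedSpace H M] [IsManifold I ω M]
  [RiemannianBundle (fun x : M ↦ TangentSpace I x)]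
  [IsContMDiffRiemannianBundle I ω E (fun x : M ↦ TangentSpace I x)]
  {J : Π x : M, TangentSpace I x →L[ℝ] TangentSpace I x}

/-- Leibniz rule along a curve for a parallel field of endomorphisms: `D_t (J V) = J (D_t V)`. -/
theorem covDerivAlong_end {γ : ℝ → M} {V : Π t : ℝ, TangentSpace I (γ t)} {t : ℝ}
    (hJ : IsParallelEndAt I J (γ t))
    (hV : MDifferentiableAt 𝓘(ℝ, ℝ) I.tangent (fun u : ℝ ↦ (⟨γ u, V u⟩ : TangentBundle I M)) t) :
    MDifferentiableAt 𝓘(ℝ, ℝ) I.tangent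
      (fun u : ℝ ↦ (⟨γ u, J (γ u) (V u)⟩ : TangentBundle I M)) t ∧
    covDerivAlong I γ (fun u ↦ J (γ u) (V u)) t = J (γ t) (covDerivAlong I γ V t) := by
  have hx := mem_chart_source H (γ t)
  have hγ : MDifferentiableAt 𝓘(ℝ, ℝ) I γ t := ((mdifferentiableAt_totalSpace I _).1 hV).1
  have hy := (mdifferentiableAt_along_iff hx hγ).1 hV
  have hj := ((isParallelEndAt_iff hx).1 hJ).2
  have hju := hj.comp_hasDerivAt t (differentiableAt_extChartAt_comp hx hγ).hasDerivAt
  have hjy := hju.clm_apply hy.hasDerivAt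
  have e : (fun s ↦ toCoord I (γ t) (γ s) (J (γ s) (V s))) =ᶠ[𝓝 t] fun s ↦
      (endCoord I (γ t) J ∘ extChartAt I (γ t) ∘ γ) s (toCoord I (γ t) (γ s) (V s)) := by
    filter_upwards [hγ.continuousAt.preimage_mem_nhds (eventually_chart_source hx)] with s hs
    exact toCoord_end hs J (V s)
  have hd := hjy.congr_of_eventuallyEq e
  refine ⟨(mdifferentiableAt_along_iff hx hγ).2 hd.differentiableAt, ?_⟩
  refine (coordEquiv I hx).injective ?_
  change toCoord I (γ t) (γ t) _ = toCoord I (γ t) (γ t) _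
  rw [toCoord_end hx J (covDerivAlong I γ V t), toCoord_covDerivAlong hx hγ hd.differentiableAt,
    toCoord_covDerivAlong hx hγ hy, hd.deriv, toCoord_end hx J (V t), map_add,
    ContinuousLinearMap.flip_apply, endConnection_apply]
  simp only [Function.comp_apply]
  abel

theorem IsParallelOn.map_end (hJ : ∀ x, IsParallelEndAt I J x) {γ : ℝ → M} {a b : ℝ}
    {V : Π t : ℝ, TangentSpace I (γ t)} (hV : IsParallelOn I γ a b V) :
    IsParallelOn I γ a b (fun t ↦ J (γ t) (V t)) := by
  obtain ⟨hc, s, hs⟩ := hV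
  refine ⟨fun t ht ↦ ?_, s, fun t ht hts ↦ ?_⟩
  · have hx := mem_chart_source H (γ t)
    have hγ : ContinuousWithinAt γ (Set.Icc a b) t :=
      (FiberBundle.continuous_proj E
        (TangentSpace I : M → Type _)).continuousAt.comp_continuousWithinAt (hc t ht)
    have hy := (continuousWithinAt_along_iff hx hγ).1 (hc t ht)
    have hj := ((isParallelEndAt_iff hx).1 (hJ (γ t))).1.continuousAt
    have hju : ContinuousWithinAt (fun s ↦ endCoord I (γ t) J (extChartAt I (γ t) (γ s)))
        (Set.Icc a b) t :=
      (hj.comp (continuousAt_extChartAt (γ t))).comp_continuousWithinAt hγ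
    refine (continuousWithinAt_along_iff hx hγ).2 ?_
    refine (hju.clm_apply hy).congr_of_eventuallyEq ?_ (toCoord_end hx J (V t))
    filter_upwards [hγ.preimage_mem_nhdsWithin (eventually_chart_source hx)] with s hs
    exact toCoord_end hs J (V s)
  · obtain ⟨h1, h2⟩ := hs t ht hts
    obtain ⟨h3, h4⟩ := covDerivAlong_end (hJ (γ t)) h1
    exact ⟨h3, by rw [h4, h2, map_zero]⟩

omit [I.Boundaryless] in
theorem IsParallelComplexStructureOn.isParallelEndAt {U : Set M} (hU : IsOpen U)
    (hJ : IsParallelComplexStructureOn I J U) {x : M} (hx : x ∈ U) : IsParallelEndAt I J x :=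
  ⟨hJ.smooth.contMDiffAt (hU.mem_nhds hx), hJ.parallel x hx⟩

omit [I.Boundaryless] in
theorem IsParallelEndAt.contMDiffAt_apply {x : M} (hJ : IsParallelEndAt I J x)
    {Y : Π x : M, TangentSpace I x}
    (hY : ContMDiffAt I I.tangent ∞ (fun y ↦ (⟨y, Y y⟩ : TangentBundle I M)) x) :
    ContMDiffAt I I.tangent ∞ (fun y ↦ (⟨y, J y (Y y)⟩ : TangentBundle I M)) x :=
  hJ.smooth.clm_bundle_apply hY

theorem IsParallelEndAt.comp_self {x : M} (hJ : ∀ᶠ y in 𝓝 x, IsParallelEndAt I J y) :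
    IsParallelEndAt I (fun y ↦ J y ∘L J y) x := by
  have hJx := hJ.self_of_nhds
  refine ⟨?_, fun Y hY v ↦ ?_⟩
  · have hx := mem_chart_source H x
    have hj := (contMDiffAt_end_iff hx J).1 hJx.smooth
    refine (contMDiffAt_end_iff hx _).2 ((hj.clm_comp hj).congr_of_eventuallyEq ?_)
    filter_upwards [eventually_symm_extChartAt (I := I) hx hJ] with z hz
    ext v
    change toCoord I x _ (J _ (J _ _)) = toCoord I x _ (J _ (ofCoord I x _ (toCoord I x _ (J _ _))))
    rw [ofCoord_toCoord hz.2.1]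
  · have h1 := hJx.parallel _ (hJx.contMDiffAt_apply hY) v
    rw [hJx.parallel _ hY] at h1
    exact h1

variable (I) in
theorem isParallelEndAt_neg_id (x : M) :
    IsParallelEndAt I (fun y ↦ -ContinuousLinearMap.id ℝ (TangentSpace I y)) x := by
  have hx := mem_chart_source H x
  have e : endCoord I x (fun y ↦ -ContinuousLinearMap.id ℝ (TangentSpace I y))
      =ᶠ[𝓝 (extChartAt I x x)] fun _ ↦ -ContinuousLinearMap.id ℝ E := by
    filter_upwards [eventually_symm_extChartAt (I := I) hx (p := fun _ ↦ True) (by simp)] with z hz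
    ext v
    change toCoord I x _ (-ofCoord I x _ v) = -v
    rw [map_neg, toCoord_ofCoord hz.2.1]
  refine (isParallelEndAt_iff hx).2 ⟨contDiffAt_const.congr_of_eventuallyEq e, ?_⟩
  rw [e.eq_of_nhds]
  have h0 : (endConnection I x (extChartAt I x x)).flip (-ContinuousLinearMap.id ℝ E) = 0 := by
    ext v w
    rw [ContinuousLinearMap.flip_apply, endConnection_apply]
    simp
  rw [h0]
  exact (hasFDerivAt_const _ _).congr_of_eventuallyEq e

omit [I.Boundaryless] in
/-- A parallel field of endomorphisms with square `-1` is integrable, since the Nijenhuis tensor can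
be expressed by covariant derivatives for the torsion-free connection `∇`. -/
theorem isParallelComplexStructureOn_univ (hJ : ∀ x, IsParallelEndAt I J x)
    (hsq : ∀ x (v : TangentSpace I x), J x (J x v) = -v) :
    IsParallelComplexStructureOn I J Set.univ where
  smooth := contMDiffOn_univ.2 fun x ↦ (hJ x).smooth
  sq x _ := hsq x
  integrable x _ X Y hX hY := by
    have : CompleteSpace E := FiniteDimensional.complete ℝ E
    have htor : ∀ {X Y : Π x : M, TangentSpace I x} {x : M}, MDiffAt (T% X) x → MDiffAt (T% Y) x →
        leviCivita I M Y x (X x) - leviCivita I M X x (Y x) = mlieBracket I X Y x :=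
      (CovariantDerivative.torsion_eq_zero_iff (leviCivita I M)).1 leviCivita_torsion
    have hmX := hX.mdifferentiableAt (by simp)
    have hmY := hY.mdifferentiableAt (by simp)
    have hmJX := ((hJ x).contMDiffAt_apply hX).mdifferentiableAt (by simp)
    have hmJY := ((hJ x).contMDiffAt_apply hY).mdifferentiableAt (by simp)
    rw [← htor hmJX hmJY, ← htor hmJX hmY, ← htor hmX hmJY, ← htor hmX hmY,
      (hJ x).parallel _ hX, (hJ x).parallel _ hX, (hJ x).parallel _ hY, (hJ x).parallel _ hY,
      map_sub, map_sub, hsq, hsq]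
    abel
  parallel x _ := (hJ x).parallel

end ComplexStructure

end RiemGeom

end

theorem lemma4p1 {n : ℕ} {M : Type*} [EMetricSpace M]
    [ChartedSpace (EuclideanSpace ℝ (Fin n)) M] [IsManifold (𝓡 n) ω M]
    [RiemannianBundle (fun x : M ↦ TangentSpace (𝓡 n) x)]
    [IsContMDiffRiemannianBundle (𝓡 n) ω (EuclideanSpace ℝ (Fin n))
      (fun x : M ↦ TangentSpace (𝓡 n) x)]
    [IsRiemannianManifold (𝓡 n) M] [CompleteSpace M] [ConnectedSpace M]
    (U : Set M) (hUo : IsOpen U) (hUc : IsConnected U) (p : M) (hp : p ∈ U)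
    (hsurj : Function.Surjective
      (FundamentalGroup.map (⟨Subtype.val, continuous_subtype_val⟩ : C(U, M)) ⟨p, hp⟩))
    (JU : Π x : M, TangentSpace (𝓡 n) x →L[ℝ] TangentSpace (𝓡 n) x)
    (hJU : RiemGeom.IsParallelComplexStructureOn (𝓡 n) JU U) :
    ∃ J : Π x : M, TangentSpace (𝓡 n) x →L[ℝ] TangentSpace (𝓡 n) x,
      RiemGeom.IsParallelComplexStructureOn (𝓡 n) J Set.univ ∧
      (∀ x ∈ U, J x = JU x) ∧
      (∀ J' : Π x : M, TangentSpace (𝓡 n) x →L[ℝ] TangentSpace (𝓡 n) x,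
        RiemGeom.IsParallelComplexStructureOn (𝓡 n) J' Set.univ → (∀ x ∈ U, J' x = JU x) →
        J' = J) ∧
      (∀ γ : ℝ → M, RiemGeom.IsPiecewiseSmoothPath (𝓡 n) γ → γ 0 = p →
        ∃ P : TangentSpace (𝓡 n) (γ 0) ≃L[ℝ] TangentSpace (𝓡 n) (γ 1),
          RiemGeom.IsParallelTransport (𝓡 n) γ P ∧
          ∀ v : TangentSpace (𝓡 n) (γ 1), J (γ 1) v = P (JU (γ 0) (P.symm v))) := by

  have : LocallyPathConnectedSpace M :=
    ChartedSpace.locallyPathConnectedSpace (EuclideanSpace ℝ (Fin n)) M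
  have hJUp : ∀ x ∈ U, RiemGeom.IsParallelEndAt (𝓡 n) JU x :=
    fun x hx ↦ hJU.isParallelEndAt hUo hx
  obtain ⟨J, hJ, hJeq⟩ := (RiemGeom.isLocallyConstant_isParallelEndAt (𝓡 n) M).exists_extension
    hUo hUc.isPreconnected hp hsurj hJUp
  have hunique : ∀ J₁ J₂ : Π x : M, TangentSpace (𝓡 n) x →L[ℝ] TangentSpace (𝓡 n) x,
      (∀ x, RiemGeom.IsParallelEndAt (𝓡 n) J₁ x) → (∀ x, RiemGeom.IsParallelEndAt (𝓡 n) J₂ x) →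
      J₁ p = J₂ p → J₁ = J₂ := fun J₁ J₂ h₁ h₂ h ↦ funext fun x ↦
    RiemGeom.isParallelEndAt_unique isOpen_univ isPreconnected_univ (fun x _ ↦ h₁ x)
      (fun x _ ↦ h₂ x) (Set.mem_univ p) h x (Set.mem_univ x)
  -- `J ∘ J` and `-1` are parallel and agree at `p`
  have hsq := hunique _ _
    (fun x ↦ RiemGeom.IsParallelEndAt.comp_self (Filter.Eventually.of_forall hJ))
    (RiemGeom.isParallelEndAt_neg_id (𝓡 n)) (ContinuousLinearMap.ext fun v ↦ by
      change J p (J p v) = -v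
      rw [hJeq p hp]
      exact hJU.sq p hp v)
  refine ⟨J, RiemGeom.isParallelComplexStructureOn_univ hJ
    (fun x v ↦ congrArg (fun L ↦ L v) (congrFun hsq x)), hJeq, fun J' hJ' hJ'U ↦ ?_,
    fun γ hγ hγp ↦ ?_⟩
  · exact hunique _ _ (fun x ↦ hJ'.isParallelEndAt isOpen_univ (Set.mem_univ x)) hJ
      ((hJ'U p hp).trans (hJeq p hp).symm)
  · obtain ⟨P, hP⟩ := RiemGeom.hasTransport_of_isPiecewiseSmoothPath hγ
    refine ⟨P, hP, fun v ↦ ?_⟩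
    obtain ⟨V, hV, hV0, rfl⟩ := (hP (P.symm v) v).2 (P.apply_symm_apply v)
    -- `J V` is parallel along `γ`, hence transport sends its initial value to its final value
    rw [← hJeq (γ 0) (hγp ▸ hp), ← hV0]
    exact ((hP _ _).1 ⟨_, RiemGeom.IsParallelOn.map_end hJ hV, rfl, rfl⟩).symm
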